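/- **Setting.** Let $\mathcal X\subset\mathbb R^d$ be compact, let $\Theta\subset\mathbb R^m$ be a set of hyperparameters, and let $(k_\theta)_{\theta\in\Theta}$ be symmetric positive semidefinite kernels on $\mathcal X$ with $k_\theta(x,x')\le 1$, jointly continuous in $(\theta,x,x')$. Let $f:\mathcal X\to\mathbb R$ and $B>0$. Assume (Assumption 1) that $\Theta$ is compact and bounded away from the origin, that $f$ lies in the reproducing kernel Hilbert space of $k_\theta$ for some $\theta\in\Theta$, and that $\sup_{\hat\theta\in\Theta}\|f\|_{k_{\hat\theta}}\le B$ (the norm being $\infty$ for a function outside the space). Let $T>1$, $\delta\in(0,1)$, $R>0$, $\sigma\ge 1$, $p\in\{1,2\}$. On a probability space with a filtration $(\mathcal F_t)_{t\ge0}$, in the rounds $t=1,\dots,T$ a query $x_t\in\mathcal X$ is selected by an arbitrary $\mathcal F_{t-1}$-measurable rule and $y_t=f(x_t)+\epsilon_t$ is observed, where $\epsilon_t$ is $\mathcal F_t$-measurable and conditionally $R$-sub-Gaussian: $\mathbb E[e^{\eta\epsilon_t}\mid\mathcal F_{t-1}]\le e^{\eta^2R^2/2}$ for all $\eta\in\mathbb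 R$. For $\hat\theta\in\Theta$ let $$\mu_{t-1}(x;\hat\theta)=\mathbf k_{\hat\theta}(x)^\top(K_{\hat\theta}+\sigma^2I)^{-1}\mathbf y_{t-1},\qquad \sigma_{t-1}^2(x;\hat\theta)=k_{\hat\theta}(x,x)-\mathbf k_{\hat\theta}(x)^\top(K_{\hat\theta}+\sigma^2I)^{-1}\mathbf k_{\hat\theta}(x)$$ be the Gaussian process posterior mean and variance given $(x_i,y_i)_{i<t}$, where $K_{\hat\theta}=[k_{\hat\theta}(x_i,x_j)]_{i,j<t}$, $\mathbf k_{\hat\theta}(x)=[k_{\hat\theta}(x_i,x)]_{i<t}$ and $\mathbf y_{t-1}=(y_i)_{i<t}$. Let $$\Gamma_n=\sup_{\hat\theta\in\Theta}\ \sup_{a_1,\dots,a_n\in\mathcal X}\tfrac12\log\det\big(I+\sigma^{-2}[k_{\hat\theta}(a_i,a_j)]_{i,j\le n}\big),$$ let $d(\theta,\theta')=\sup_{x,x'}|k_\theta(x,x')-k_{\theta'}(x,x')|$, let $\varepsilon_T=T^{-4}$, let $\mathcal N$ be the $\varepsilon_T$-covering number of $\Theta$ under $d$ (with centers in $\Theta$),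 and put $$\beta_t^{1/2}=B+R\sqrt{2\big(\Gamma_{t-1}+1+\log(6\mathcal N/\delta)\big)},\qquad L_t^c(\hat\theta)=\left(\frac{|y_t-\mu_{t-1}(x_t;\hat\theta)|}{\beta_t^{1/2}\sqrt{\sigma_{t-1}^2(x_t;\hat\theta)+\sigma^2}}\right)^{p}-1,$$ $$\rho=\sup_{\hat\theta\in\Theta}\frac1T\sum_{t=1}^T-L_t^c(\hat\theta),\qquad \hat\rho=\begin{cases}0.065,&p=1,\\ \dfrac{\sigma^2}{4(1+\sigma^2)},&p=2,\end{cases}$$ $$L_{\sigma^2_{t-1}}=\Big(1+\frac{t-1}{\sigma^2}\Big)^2,\qquad L_{\mu_{t-1}}=\|\mathbf y_{t-1}\|_2\Big(\frac{\sqrt{t-1}}{\sigma^2}+\frac{\sqrt{t-1}\,(t-1)}{\sigma^4}\Big).$$ **Theorem.** There is an event of probability at least $1-\delta/2$ on which both of the following hold: 1. $\rho\ge\hat\rho>0$; 2. for all $t\in\{1,\dots,T\}$, $x\in\mathcal X$ and $\hat\theta\in\Theta$, $$|f(x)-\mu_{t-1}(x;\hat\theta)|\le\beta_t^{1/2}\,\sigma_{t-1}(x;\hat\theta)+\sqrt{L_{\sigma^2_{t-1}}\,\varepsilon_T}+L_{\mu_{t-1}}\,\varepsilon_T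 .$$ -/

import Mathlib

open MeasureTheory ProbabilityTheory
open scoped ENNReal Matrix

noncomputable section

namespace OSCBO

/-! ### Kernels and their reproducing kernel Hilbert spaces -/

section Kernel

variable {𝒳 : Type*}

/-- A (real, scalar) kernel: symmetric and positive semidefinite. -/
def IsKernel (k : 𝒳 → 𝒳 → ℝ) : Prop := (Matrix.of k).PosSemidef

/-- The scalar kernel `k` as an operator-valued one, the form in which Mathlib builds the RKHS. -/
def opKernel (k : 𝒳 → 𝒳 → ℝ) : Matrix 𝒳 𝒳 (ℝ →L[ℝ] ℝ) :=
  Matrix.of fun x x' => k x x' • ContinuousLinearMap.id ℝ ℝ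

theorem IsKernel.posSemidef_opKernel {k : 𝒳 → 𝒳 → ℝ} (hk : IsKernel k) :
    (opKernel k).PosSemidef := by
  have key := (RKHS.posSemidef_tfae (K := opKernel k)).out 0 2
  refine key.mpr ⟨?_, fun v => ?_⟩
  · ext x x'
    have h := hk.1.apply x x'
    simp only [Matrix.of_apply, star_trivial] at h
    have h1 : star (ContinuousLinearMap.id ℝ ℝ) = ContinuousLinearMap.id ℝ ℝ :=
      star_one (ℝ →L[ℝ] ℝ)
    simp [opKernel, h, h1]
  · have h := hk.2 v
    rw [Finsupp.sum_comm]
    simpa [opKernel, mul_comm, mul_left_comm] using h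

/-- The norm of `f` in the reproducing kernel Hilbert space of `k`, with value `∞` if `f` does not
belong to that space (at most one `h` in the space has `⇑h = f`). -/
def rkhsNorm {k : 𝒳 → 𝒳 → ℝ} (hk : IsKernel k) (f : 𝒳 → ℝ) : ℝ≥0∞ :=
  haveI : Fact (opKernel k).PosSemidef := ⟨hk.posSemidef_opKernel⟩
  ⨅ (h : RKHS.OfKernel (opKernel k)) (_ : ⇑h = f), ‖h‖ₑ

/-! ### Gaussian process posterior and information gain -/

variable {n : ℕ}

/-- The Gram matrix of the points `a`. -/
def gram (k : 𝒳 → 𝒳 → ℝ) (a : Fin n → 𝒳) : Matrix (Fin n) (Fin n) ℝ :=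
  Matrix.of fun i j => k (a i) (a j)

/-- The vector `(k (a i) x)_i`. -/
def kvec (k : 𝒳 → 𝒳 → ℝ) (a : Fin n → 𝒳) (x : 𝒳) : Fin n → ℝ := fun i => k (a i) x

/-- Posterior mean at `x` given the data `(a i, y i)`, with noise parameter `σ ^ 2`. -/
def postMean (k : 𝒳 → 𝒳 → ℝ) (σ : ℝ) (a : Fin n → 𝒳) (y : Fin n → ℝ) (x : 𝒳) : ℝ :=
  kvec k a x ⬝ᵥ ((gram k a + σ ^ 2 • (1 : Matrix (Fin n) (Fin n) ℝ))⁻¹ *ᵥ y)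

/-- Posterior variance at `x` given the inputs `a`, with noise parameter `σ ^ 2`. -/
def postVar (k : 𝒳 → 𝒳 → ℝ) (σ : ℝ) (a : Fin n → 𝒳) (x : 𝒳) : ℝ :=
  k x x - kvec k a x ⬝ᵥ ((gram k a + σ ^ 2 • (1 : Matrix (Fin n) (Fin n) ℝ))⁻¹ *ᵥ kvec k a x)

/-- Posterior standard deviation. -/
def postStd (k : 𝒳 → 𝒳 → ℝ) (σ : ℝ) (a : Fin n → 𝒳) (x : 𝒳) : ℝ := √(postVar k σ a x)

/-- Information gain of the points `a`. -/
def infoGain (k : 𝒳 → 𝒳 → ℝ) (σ : ℝ) (a : Fin n → 𝒳) : ℝ :=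
  1 / 2 * Real.log (1 + (σ ^ 2)⁻¹ • gram k a).det

/-- Maximum information gain `γ_n` after `n` evaluations (evaluations may be repeated). -/
def maxInfoGain (k : 𝒳 → 𝒳 → ℝ) (σ : ℝ) (n : ℕ) : ℝ := ⨆ a : Fin n → 𝒳, infoGain k σ a

/-- `sup_{x, x'} |k₁(x, x') - k₂(x, x')|`. -/
def kernelDist (k₁ k₂ : 𝒳 → 𝒳 → ℝ) : ℝ := ⨆ q : 𝒳 × 𝒳, |k₁ q.1 q.2 - k₂ q.1 q.2|

end Kernel

/-! ### Families of kernels -/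

section Family

variable {𝒳 H : Type*}

/-- `Γ_n`, the maximum over the family of the maximum information gain after `n` evaluations. -/
def familyInfoGain (k : H → 𝒳 → 𝒳 → ℝ) (σ : ℝ) (n : ℕ) : ℝ := ⨆ θ : H, maxInfoGain (k θ) σ n

/-- The `ε`-covering number of the family with respect to `kernelDist`. -/
def coveringNumber (k : H → 𝒳 → 𝒳 → ℝ) (ε : ℝ) : ℕ :=
  sInf {N : ℕ | ∃ s : Finset H, s.card = N ∧ ∀ θ, ∃ θ' ∈ s, kernelDist (k θ) (k θ') ≤ ε}

/-- The resolution `ε_T = T⁻⁴`. -/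
def resolution (T : ℕ) : ℝ := ((T : ℝ) ^ 4)⁻¹

/-- The exploration scale `β_t^{1/2}` of round `t = n + 1`. -/
def betaSqrt (k : H → 𝒳 → 𝒳 → ℝ) (σ B R δ : ℝ) (T n : ℕ) : ℝ :=
  B + R * √(2 * (familyInfoGain k σ n + 1
    + Real.log (6 * (coveringNumber k (resolution T) : ℝ) / δ)))

/-- The calibration constraint `L_t^c(θ)` of round `t = n + 1`; the query and the observation of
round `t` are `x n` and `y n`, the earlier ones are `x i` and `y i` with `i < n`. -/
def calibLoss (k : H → 𝒳 → 𝒳 → ℝ) (σ B R δ : ℝ) (T p : ℕ) (x : ℕ → 𝒳) (y : ℕ → ℝ) (n : ℕ)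
    (θ : H) : ℝ :=
  |y n - postMean (k θ) σ (fun i : Fin n => x i) (fun i => y i) (x n)| ^ p
    / (betaSqrt k σ B R δ T n
        * √(postVar (k θ) σ (fun i : Fin n => x i) (x n) + σ ^ 2)) ^ p - 1

/-- The feasibility margin `ρ = sup_θ T⁻¹ ∑_t -L_t^c(θ)`. -/
def feasibilityMargin (k : H → 𝒳 → 𝒳 → ℝ) (σ B R δ : ℝ) (T p : ℕ) (x : ℕ → 𝒳) (y : ℕ → ℝ) : ℝ :=
  ⨆ θ : H, 1 / (T : ℝ) * ∑ n ∈ Finset.range T, -calibLoss k σ B R δ T p x y n θ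

/-- The lower bound `ρ̂` on the feasibility margin, for the exponents `p = 1` and `p = 2`. -/
def marginBound (σ : ℝ) (p : ℕ) : ℝ := if p = 1 then 0.065 else σ ^ 2 / (4 * (1 + σ ^ 2))

/-- Lipschitz constant `L_{σ²}`, with respect to `kernelDist`, of the posterior variance given `n`
data points. -/
def lipVar (σ : ℝ) (n : ℕ) : ℝ := (1 + n / σ ^ 2) ^ 2

/-- Lipschitz constant `L_μ`, with respect to `kernelDist`, of the posterior mean given `n` data
points with observations `y`; it is proportional to the Euclidean norm of `y`. -/
def lipMean (σ : ℝ) {n : ℕ} (y : Fin n → ℝ) : ℝ :=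
  √(∑ i, y i ^ 2) * (√n / σ ^ 2 + √n * n / σ ^ 4)

end Family

/-- The standing assumption on the hyperparameter space `Θ`, on the family of kernels indexed by it
and on the objective `f`. -/
structure RKHSAssumption {m : ℕ} (Θ : Set (Fin m → ℝ)) {𝒳 : Type*} {k : Θ → 𝒳 → 𝒳 → ℝ}
    (hk : ∀ θ, IsKernel (k θ)) (f : 𝒳 → ℝ) (B : ℝ) : Prop where
  isCompact : IsCompact Θ
  away : ∃ c : ℝ, 0 < c ∧ ∀ θ ∈ Θ, c ≤ ‖θ‖
  mem_rkhs : ∃ θ, rkhsNorm (hk θ) f < ∞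
  norm_le : (⨆ θ, rkhsNorm (hk θ) f) ≤ ENNReal.ofReal B

/-- The noise `ε` is conditionally `R`-sub-Gaussian in the first `T` rounds; round `t = n + 1` has
noise `ε n`, and `ℱ n` is the information available before its observation is revealed. -/
def CondSubGaussian {Ω : Type*} {mΩ : MeasurableSpace Ω} (P : Measure Ω) (ℱ : Filtration ℕ mΩ)
    (ε : ℕ → Ω → ℝ) (R : ℝ) (T : ℕ) : Prop :=
  ∀ n < T, ∀ η : ℝ, Integrable (fun ω => Real.exp (η * ε n ω)) P ∧
    P[fun ω => Real.exp (η * ε n ω) | ℱ n] ≤ᵐ[P] fun _ => Real.exp (η ^ 2 * R ^ 2 / 2)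

end OSCBO

end

open OSCBO

/-
The prediction error at `z` splits into a bias, at most `‖f‖ * postStd` by Cauchy–Schwarz in the
RKHS, and a noise term, at most `√(fitQuad ξ) / σ * postStd`, where `fitQuad ξ` is the quadratic
form of `K (K + σ²)⁻¹` at the noise vector `ξ`.

For one kernel, `exp (fitQuad ξ / 2 - infoGain)` is dominated by a product of Gaussian mixtures of
the exponential supermartingales `exp (η ξ - η² / 2)`, so Ville's inequality bounds `fitQuad ξ`
uniformly in time. A union bound extends this to a minimal net of the family. Moving from the net to
an arbitrary hyperparameter changes `fitQuad ξ` by at most a multiple of `T⁻⁴ * ∑ ξ²`; the same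
mixture argument controls this energy, and the resulting error fits into the summand `1` of
`betaSqrt`, so that no Lipschitz correction is needed.

For the feasibility margin, the squared prediction errors normalized by the predictive variances sum
exactly to `yᵀ (K + σ²)⁻¹ y`, which is at most `‖f‖² + ∑ ε² / σ²`. Hence the squared calibration
ratios of a single hyperparameter already average to at most `3 / 4`.
-/

noncomputable section

namespace OSCBO

section Regression

variable {𝒳 : Type*} {k k' : 𝒳 → 𝒳 → ℝ} {σ : ℝ} {n : ℕ}

theorem dotProduct_self_nonneg (v : Fin n → ℝ) : 0 ≤ v ⬝ᵥ v := by
  simpa using dotProduct_star_self_nonneg v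

theorem dotProduct_mulVec_comm {A : Matrix (Fin n) (Fin n) ℝ} (hA : A.IsSymm) (v w : Fin n → ℝ) :
    v ⬝ᵥ (A *ᵥ w) = w ⬝ᵥ (A *ᵥ v) := by
  rw [Matrix.dotProduct_mulVec, ← Matrix.mulVec_transpose, hA.eq, dotProduct_comm]

theorem dotProduct_snoc_snoc (v w : Fin n → ℝ) (s t : ℝ) :
    (Fin.snoc v s : Fin (n + 1) → ℝ) ⬝ᵥ (Fin.snoc w t : Fin (n + 1) → ℝ) = v ⬝ᵥ w + s * t := by
  simp [dotProduct, Fin.sum_univ_castSucc]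

/-- The regularized Gram matrix `K + σ² I`. -/
def regGram (k : 𝒳 → 𝒳 → ℝ) (σ : ℝ) (a : Fin n → 𝒳) : Matrix (Fin n) (Fin n) ℝ :=
  gram k a + σ ^ 2 • (1 : Matrix (Fin n) (Fin n) ℝ)

/-- The quadratic form `yᵀ (K + σ² I)⁻¹ y`, which is the sum of the squared normalized one-step
prediction errors along the data. -/
def invQuad (k : 𝒳 → 𝒳 → ℝ) (σ : ℝ) (a : Fin n → 𝒳) (y : Fin n → ℝ) : ℝ :=
  y ⬝ᵥ ((regGram k σ a)⁻¹ *ᵥ y)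

/-- The quadratic form `yᵀ K (K + σ² I)⁻¹ y`, the squared self-normalized norm of the noise in the
confidence bound. It is encoded as `|y|² - σ² yᵀ (K + σ² I)⁻¹ y`. -/
def fitQuad (k : 𝒳 → 𝒳 → ℝ) (σ : ℝ) (a : Fin n → 𝒳) (y : Fin n → ℝ) : ℝ :=
  y ⬝ᵥ y - σ ^ 2 * invQuad k σ a y

theorem postMean_eq (k : 𝒳 → 𝒳 → ℝ) (σ : ℝ) (a : Fin n → 𝒳) (y : Fin n → ℝ) (z : 𝒳) :
    postMean k σ a y z = kvec k a z ⬝ᵥ ((regGram k σ a)⁻¹ *ᵥ y) := rfl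

theorem postVar_eq (k : 𝒳 → 𝒳 → ℝ) (σ : ℝ) (a : Fin n → 𝒳) (z : 𝒳) :
    postVar k σ a z = k z z - kvec k a z ⬝ᵥ ((regGram k σ a)⁻¹ *ᵥ kvec k a z) := rfl

theorem postMean_add (k : 𝒳 → 𝒳 → ℝ) (σ : ℝ) (a : Fin n → 𝒳) (y y' : Fin n → ℝ) (z : 𝒳) :
    postMean k σ a (y + y') z = postMean k σ a y z + postMean k σ a y' z := by
  simp only [postMean_eq, Matrix.mulVec_add, dotProduct_add]

theorem fitQuad_smul (k : 𝒳 → 𝒳 → ℝ) (σ : ℝ) (a : Fin n → 𝒳) (c : ℝ) (y : Fin n → ℝ) :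
    fitQuad k σ a (c • y) = c ^ 2 * fitQuad k σ a y := by
  simp only [fitQuad, invQuad, Matrix.mulVec_smul, dotProduct_smul, smul_dotProduct, smul_eq_mul]
  ring

theorem regGram_mulVec (k : 𝒳 → 𝒳 → ℝ) (σ : ℝ) (a : Fin n → 𝒳) (v : Fin n → ℝ) :
    regGram k σ a *ᵥ v = gram k a *ᵥ v + σ ^ 2 • v := by
  rw [regGram, Matrix.add_mulVec, Matrix.smul_mulVec, Matrix.one_mulVec]

theorem dotProduct_regGram_mulVec (k : 𝒳 → 𝒳 → ℝ) (σ : ℝ) (a : Fin n → 𝒳) (v w : Fin n → ℝ) :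
    v ⬝ᵥ (regGram k σ a *ᵥ w) = v ⬝ᵥ (gram k a *ᵥ w) + σ ^ 2 * (v ⬝ᵥ w) := by
  rw [regGram_mulVec, dotProduct_add, dotProduct_smul, smul_eq_mul]

namespace IsKernel

theorem symm (hk : IsKernel k) (x x' : 𝒳) : k x x' = k x' x := by
  simpa using (hk.1.apply x x').symm

theorem posSemidef_gram (hk : IsKernel k) (a : Fin n → 𝒳) : (gram k a).PosSemidef :=
  hk.submatrix a

theorem dotProduct_gram_nonneg (hk : IsKernel k) (a : Fin n → 𝒳) (v : Fin n → ℝ) :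
    0 ≤ v ⬝ᵥ (gram k a *ᵥ v) := by
  simpa using (hk.posSemidef_gram a).dotProduct_mulVec_nonneg v

theorem isSymm_gram (hk : IsKernel k) (a : Fin n → 𝒳) : (gram k a).IsSymm :=
  Matrix.IsSymm.ext fun _ _ => hk.symm _ _

theorem isSymm_regGram (hk : IsKernel k) (a : Fin n → 𝒳) : (regGram k σ a).IsSymm :=
  (hk.isSymm_gram a).add (Matrix.isSymm_one.smul _)

theorem posDef_regGram (hk : IsKernel k) (hσ : 0 < σ) (a : Fin n → 𝒳) : (regGram k σ a).PosDef :=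
  Matrix.PosDef.posSemidef_add (hk.posSemidef_gram a) (Matrix.PosDef.one.smul (by positivity))

theorem isUnit_det_regGram (hk : IsKernel k) (hσ : 0 < σ) (a : Fin n → 𝒳) :
    IsUnit (regGram k σ a).det :=
  (hk.posDef_regGram hσ a).det_pos.ne'.isUnit

theorem regGram_mulVec_inv_mulVec (hk : IsKernel k) (hσ : 0 < σ) (a : Fin n → 𝒳)
    (v : Fin n → ℝ) : regGram k σ a *ᵥ ((regGram k σ a)⁻¹ *ᵥ v) = v := by
  rw [Matrix.mulVec_mulVec, Matrix.mul_nonsing_inv _ (hk.isUnit_det_regGram hσ a),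
    Matrix.one_mulVec]

theorem inv_mulVec_eq (hk : IsKernel k) (hσ : 0 < σ) (a : Fin n → 𝒳) {v w : Fin n → ℝ}
    (h : regGram k σ a *ᵥ w = v) : (regGram k σ a)⁻¹ *ᵥ v = w := by
  rw [← h, Matrix.mulVec_mulVec, Matrix.nonsing_inv_mul _ (hk.isUnit_det_regGram hσ a),
    Matrix.one_mulVec]

theorem dotProduct_inv_mulVec_comm (hk : IsKernel k) (a : Fin n → 𝒳) (v w : Fin n → ℝ) :
    v ⬝ᵥ ((regGram k σ a)⁻¹ *ᵥ w) = w ⬝ᵥ ((regGram k σ a)⁻¹ *ᵥ v) :=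
  dotProduct_mulVec_comm (hk.isSymm_regGram a).inv v w

theorem invQuad_eq_gram_add (hk : IsKernel k) (hσ : 0 < σ) (a : Fin n → 𝒳) (y : Fin n → ℝ) :
    invQuad k σ a y = ((regGram k σ a)⁻¹ *ᵥ y) ⬝ᵥ (gram k a *ᵥ ((regGram k σ a)⁻¹ *ᵥ y))
      + σ ^ 2 * (((regGram k σ a)⁻¹ *ᵥ y) ⬝ᵥ ((regGram k σ a)⁻¹ *ᵥ y)) := by
  rw [← dotProduct_regGram_mulVec, hk.regGram_mulVec_inv_mulVec hσ, dotProduct_comm, invQuad]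

theorem fitQuad_nonneg (hk : IsKernel k) (hσ : 0 < σ) (a : Fin n → 𝒳) (y : Fin n → ℝ) :
    0 ≤ fitQuad k σ a y := by
  have hAw := hk.regGram_mulVec_inv_mulVec hσ a y
  rw [fitQuad, invQuad]
  set w := (regGram k σ a)⁻¹ *ᵥ y
  have hfit : y ⬝ᵥ y - σ ^ 2 * (y ⬝ᵥ w)
      = (gram k a *ᵥ w) ⬝ᵥ (gram k a *ᵥ w) + σ ^ 2 * (w ⬝ᵥ (gram k a *ᵥ w)) := by
    rw [← hAw, regGram_mulVec]
    simp only [dotProduct_add, add_dotProduct, dotProduct_smul, smul_dotProduct, smul_eq_mul]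
    rw [dotProduct_comm w]
    ring
  rw [hfit]
  have := dotProduct_self_nonneg (gram k a *ᵥ w)
  have := hk.dotProduct_gram_nonneg a w
  positivity

end IsKernel

end Regression

section Feature

variable {𝒳 E : Type*} [NormedAddCommGroup E] [InnerProductSpace ℝ E] {k : 𝒳 → 𝒳 → ℝ} {φ : 𝒳 → E}
  {σ B : ℝ} {n : ℕ}

/-- `φ` is a feature map of the kernel `k`. -/
def IsFeatureMap (k : 𝒳 → 𝒳 → ℝ) (φ : 𝒳 → E) : Prop := ∀ x x', inner ℝ (φ x) (φ x') = k x x'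

theorem IsKernel.exists_mem_rkhs (hk : IsKernel k) [Fact (opKernel k).PosSemidef] {f : 𝒳 → ℝ}
    (hB : 0 ≤ B) (hf : rkhsNorm hk f ≤ ENNReal.ofReal B) :
    ∃ h : RKHS.OfKernel (opKernel k), ⇑h = f ∧ ‖h‖ ≤ B := by
  obtain ⟨h, hhf⟩ : ∃ h : RKHS.OfKernel (opKernel k), ⇑h = f := by
    by_contra! hne
    have : rkhsNorm hk f = ∞ := iInf₂_eq_top.2 fun h hh => absurd hh (hne h)
    simp [this] at hf
  have hnorm : rkhsNorm hk f = ‖h‖ₑ := by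
    refine le_antisymm (iInf₂_le h hhf) (le_iInf₂ fun g hg => ?_)
    rw [DFunLike.coe_injective (hg.trans hhf.symm)]
  rw [hnorm, ← ofReal_norm, ENNReal.ofReal_le_ofReal_iff hB] at hf
  exact ⟨h, hhf, hf⟩

theorem IsKernel.exists_isFeatureMap.{u} {𝒳 : Type u} {k : 𝒳 → 𝒳 → ℝ} (hk : IsKernel k) :
    ∃ (E : Type u) (_ : NormedAddCommGroup E) (_ : InnerProductSpace ℝ E) (φ : 𝒳 → E),
      IsFeatureMap k φ ∧ ∀ (f : 𝒳 → ℝ) (B : ℝ), 0 ≤ B → rkhsNorm hk f ≤ ENNReal.ofReal B →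
        ∃ h : E, ‖h‖ ≤ B ∧ ∀ x, f x = inner ℝ (φ x) h := by
  have : Fact (opKernel k).PosSemidef := ⟨hk.posSemidef_opKernel⟩
  refine ⟨RKHS.OfKernel (opKernel k), inferInstance, inferInstance,
    fun x => RKHS.kerFun (RKHS.OfKernel (opKernel k)) x 1, fun x x' => ?_, fun f B hB hf => ?_⟩
  · rw [RKHS.kerFun_inner, RKHS.kerFun_apply, RKHS.OfKernel.kernel_ofKernel]
    simp [opKernel]
  · obtain ⟨h, hhf, hhB⟩ := hk.exists_mem_rkhs hB hf
    exact ⟨h, hhB, fun x => by simp [RKHS.kerFun_inner, hhf]⟩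

theorem inner_sum_smul_left (u : Fin n → E) (v : Fin n → ℝ) (h : E) :
    inner ℝ (∑ i, v i • u i) h = v ⬝ᵥ fun i => inner ℝ (u i) h := by
  simp [sum_inner, inner_smul_left, dotProduct]

namespace IsFeatureMap

theorem inner_sum_apply (hφ : IsFeatureMap k φ) (a : Fin n → 𝒳) (v : Fin n → ℝ) (z : 𝒳) :
    inner ℝ (∑ i, v i • φ (a i)) (φ z) = v ⬝ᵥ kvec k a z := by
  simp only [inner_sum_smul_left (fun i => φ (a i)), hφ _ z]
  rfl

theorem norm_sum_sq (hφ : IsFeatureMap k φ) (a : Fin n → 𝒳) (v : Fin n → ℝ) :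
    ‖∑ i, v i • φ (a i)‖ ^ 2 = v ⬝ᵥ (gram k a *ᵥ v) := by
  rw [← real_inner_self_eq_norm_sq, inner_sum_smul_left (fun i => φ (a i))]
  congr 1
  funext i
  simp [inner_sum, inner_smul_right, hφ _ _, gram, Matrix.mulVec, dotProduct, mul_comm]

theorem postVar_eq_norm_sub_sq_add (hφ : IsFeatureMap k φ) (hk : IsKernel k) (hσ : 0 < σ)
    (a : Fin n → 𝒳) (z : 𝒳) :
    postVar k σ a z
      = ‖φ z - ∑ i, ((regGram k σ a)⁻¹ *ᵥ kvec k a z) i • φ (a i)‖ ^ 2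
        + σ ^ 2 * (((regGram k σ a)⁻¹ *ᵥ kvec k a z) ⬝ᵥ ((regGram k σ a)⁻¹ *ᵥ kvec k a z)) := by
  have hquad := hk.invQuad_eq_gram_add hσ a (kvec k a z)
  rw [postVar_eq, norm_sub_sq_real, hφ.norm_sum_sq, real_inner_comm, hφ.inner_sum_apply,
    ← real_inner_self_eq_norm_sq, hφ]
  rw [invQuad] at hquad
  rw [dotProduct_comm _ (kvec k a z)]
  linarith

end IsFeatureMap

namespace IsKernel

theorem abs_le_one (hk : IsKernel k) (hk1 : ∀ x x', k x x' ≤ 1) (x x' : 𝒳) : |k x x'| ≤ 1 := by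
  obtain ⟨E, _, _, φ, hφ, -⟩ := hk.exists_isFeatureMap
  have hnorm : ∀ z, ‖φ z‖ ≤ 1 := fun z => by
    rw [← sq_le_one_iff₀ (norm_nonneg _), ← real_inner_self_eq_norm_sq, hφ]
    exact hk1 z z
  calc |k x x'| = |inner ℝ (φ x) (φ x')| := by rw [hφ]
    _ ≤ ‖φ x‖ * ‖φ x'‖ := abs_real_inner_le_norm _ _
    _ ≤ 1 := mul_le_one₀ (hnorm x) (norm_nonneg _) (hnorm x')

theorem postVar_nonneg (hk : IsKernel k) (hσ : 0 < σ) (a : Fin n → 𝒳) (z : 𝒳) :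
    0 ≤ postVar k σ a z := by
  obtain ⟨E, _, _, φ, hφ, -⟩ := hk.exists_isFeatureMap
  rw [hφ.postVar_eq_norm_sub_sq_add hk hσ]
  have := dotProduct_self_nonneg ((regGram k σ a)⁻¹ *ᵥ kvec k a z)
  positivity

theorem abs_sub_postMean_le (hk : IsKernel k) (hσ : 0 < σ) {f : 𝒳 → ℝ} (hB : 0 ≤ B)
    (hf : rkhsNorm hk f ≤ ENNReal.ofReal B) (a : Fin n → 𝒳) (z : 𝒳) :
    |f z - postMean k σ a (fun i => f (a i)) z| ≤ B * postStd k σ a z := by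
  obtain ⟨E, _, _, φ, hφ, hrep⟩ := hk.exists_isFeatureMap
  obtain ⟨h, hhB, hfh⟩ := hrep f B hB hf
  have hvar := hφ.postVar_eq_norm_sub_sq_add hk hσ a z
  rw [postMean_eq, hk.dotProduct_inv_mulVec_comm]
  set c := (regGram k σ a)⁻¹ *ᵥ kvec k a z
  set u := φ z - ∑ i, c i • φ (a i) with hu
  have hbias : f z - (fun i => f (a i)) ⬝ᵥ c = inner ℝ h u := by
    rw [real_inner_comm, hu, inner_sub_left, inner_sum_smul_left (fun i => φ (a i)),
      dotProduct_comm]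
    simp only [hfh]
  have hstd : ‖u‖ ≤ postStd k σ a z := by
    refine Real.le_sqrt_of_sq_le ?_
    rw [hvar]
    exact le_add_of_nonneg_right (mul_nonneg (sq_nonneg σ) (dotProduct_self_nonneg c))
  rw [hbias]
  exact (abs_real_inner_le_norm h u).trans (mul_le_mul hhB hstd (norm_nonneg u) hB)

theorem invQuad_add_le (hk : IsKernel k) (hσ : 0 < σ) {f : 𝒳 → ℝ} (hB : 0 ≤ B)
    (hf : rkhsNorm hk f ≤ ENNReal.ofReal B) (a : Fin n → 𝒳) (e : Fin n → ℝ) :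
    invQuad k σ a (fun i => f (a i) + e i) ≤ B ^ 2 + e ⬝ᵥ e / σ ^ 2 := by
  obtain ⟨E, _, _, φ, hφ, hrep⟩ := hk.exists_isFeatureMap
  obtain ⟨h, hhB, hfh⟩ := hrep f B hB hf
  have hquad := hk.invQuad_eq_gram_add hσ a fun i => f (a i) + e i
  rw [← hφ.norm_sum_sq] at hquad
  have hdef : invQuad k σ a (fun i => f (a i) + e i) = (fun i => f (a i) + e i) ⬝ᵥ _ := rfl
  set Q := invQuad k σ a fun i => f (a i) + e i
  set w := (regGram k σ a)⁻¹ *ᵥ fun i => f (a i) + e i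
  set u := ∑ i, w i • φ (a i) with hu
  have hsplit : Q = inner ℝ u h + w ⬝ᵥ e := by
    rw [hdef, dotProduct_comm, hu, inner_sum_smul_left (fun i => φ (a i)), ← dotProduct_add]
    simp only [← hfh]
    rfl
  have hsignal : 2 * inner ℝ u h ≤ ‖u‖ ^ 2 + B ^ 2 := by
    nlinarith [real_inner_le_norm u h, norm_nonneg u, norm_nonneg h, sq_nonneg (‖u‖ - ‖h‖)]
  have hnoise : 2 * (w ⬝ᵥ e) ≤ σ ^ 2 * (w ⬝ᵥ w) + e ⬝ᵥ e / σ ^ 2 := by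
    have := dotProduct_self_nonneg (σ • w - σ⁻¹ • e)
    simp only [dotProduct_sub, sub_dotProduct, dotProduct_smul, smul_dotProduct, smul_eq_mul,
      dotProduct_comm e w] at this
    field_simp at this ⊢
    linarith
  linarith

end IsKernel

end Feature

section Sequential

variable {𝒳 : Type*} {k : 𝒳 → 𝒳 → ℝ} {σ : ℝ} {n : ℕ}

/-- The initial segment `u 0, …, u (n - 1)` of a sequence, that is, the data available before the
`n`-th query; an abbreviation, so that it unfolds to the form used in the loss and the margin. -/
abbrev initSeg {α : Type*} (u : ℕ → α) (n : ℕ) : Fin n → α := fun i => u i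

theorem initSeg_succ {α : Type*} (u : ℕ → α) (n : ℕ) :
    initSeg u (n + 1) = Fin.snoc (α := fun _ => α) (initSeg u n) (u n) := by
  funext i
  refine Fin.lastCases ?_ (fun i => ?_) i <;> simp [initSeg]

theorem dotProduct_initSeg (u v : ℕ → ℝ) (n : ℕ) :
    initSeg u n ⬝ᵥ initSeg v n = ∑ i ∈ Finset.range n, u i * v i :=
  Fin.sum_univ_eq_sum_range (fun i => u i * v i) n

namespace IsKernel

theorem regGram_snoc_mulVec_snoc (hk : IsKernel k) (a : Fin n → 𝒳) (z : 𝒳) (v : Fin n → ℝ)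
    (t : ℝ) :
    regGram k σ (Fin.snoc a z) *ᵥ (Fin.snoc v t : Fin (n + 1) → ℝ)
      = (Fin.snoc (regGram k σ a *ᵥ v + t • kvec k a z)
          (kvec k a z ⬝ᵥ v + t * (k z z + σ ^ 2)) : Fin (n + 1) → ℝ) := by
  simp only [regGram_mulVec]
  funext i
  refine Fin.lastCases ?_ (fun i => ?_) i
  · simp [gram, kvec, Matrix.mulVec, dotProduct, Fin.sum_univ_castSucc, hk.symm z]
    ring
  · simp [gram, kvec, Matrix.mulVec, dotProduct, Fin.sum_univ_castSucc]
    ring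

theorem det_regGram_snoc (hk : IsKernel k) (hσ : 0 < σ) (a : Fin n → 𝒳) (z : 𝒳) :
    (regGram k σ (Fin.snoc a z : Fin (n + 1) → 𝒳)).det
      = (regGram k σ a).det * (postVar k σ a z + σ ^ 2) := by
  let : Invertible (regGram k σ a) :=
    Matrix.invertibleOfIsUnitDet _ (hk.isUnit_det_regGram hσ a)
  have hblock : (regGram k σ (Fin.snoc a z : Fin (n + 1) → 𝒳)).submatrix
      (finSumFinEquiv (m := n) (n := 1)) finSumFinEquiv
      = Matrix.fromBlocks (regGram k σ a) (Matrix.of fun i _ => kvec k a z i)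
        (Matrix.of fun _ j => kvec k a z j) (Matrix.of fun _ _ => k z z + σ ^ 2) := by
    have hcast : ∀ i : Fin n, Fin.castAdd 1 i = i.castSucc := fun _ => rfl
    have hlast : ∀ i : Fin 1, Fin.natAdd n i = Fin.last n := fun i => by fin_cases i; rfl
    ext (i | i) (j | j) <;>
      simp [regGram, gram, kvec, Matrix.one_apply, hcast, hlast, hk.symm z,
        eq_comm (a := Fin.last n)]
  rw [← Matrix.det_submatrix_equiv_self (finSumFinEquiv (m := n) (n := 1)), hblock,
    Matrix.det_fromBlocks₁₁, Matrix.det_fin_one, Matrix.invOf_eq_nonsing_inv, postVar_eq,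
    Matrix.dotProduct_mulVec]
  congr 1
  simp only [Matrix.sub_apply, Matrix.of_apply, Matrix.mul_apply, dotProduct, Matrix.vecMul]
  ring

theorem invQuad_snoc (hk : IsKernel k) (hσ : 0 < σ) (a : Fin n → 𝒳) (z : 𝒳) (y : Fin n → ℝ)
    (t : ℝ) :
    invQuad k σ (Fin.snoc a z : Fin (n + 1) → 𝒳) (Fin.snoc y t)
      = invQuad k σ a y + (t - postMean k σ a y z) ^ 2 / (postVar k σ a z + σ ^ 2) := by
  have hv := hk.postVar_nonneg hσ a z
  have hs : postVar k σ a z + σ ^ 2 ≠ 0 := by positivity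
  set s := postVar k σ a z + σ ^ 2 with hsdef
  set γ := (t - postMean k σ a y z) / s with hγ
  set u := (regGram k σ a)⁻¹ *ᵥ y
  set c := (regGram k σ a)⁻¹ *ᵥ kvec k a z
  have hmean : kvec k a z ⬝ᵥ u = postMean k σ a y z := rfl
  have hmean' : y ⬝ᵥ c = postMean k σ a y z := hk.dotProduct_inv_mulVec_comm a _ _
  have hvar : kvec k a z ⬝ᵥ c = k z z + σ ^ 2 - s := by rw [hsdef, postVar_eq]; ring
  have hsol : regGram k σ (Fin.snoc a z : Fin (n + 1) → 𝒳) *ᵥ (Fin.snoc (u - γ • c) γ)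
      = (Fin.snoc y t : Fin (n + 1) → ℝ) := by
    rw [hk.regGram_snoc_mulVec_snoc, Matrix.mulVec_sub, Matrix.mulVec_smul,
      hk.regGram_mulVec_inv_mulVec hσ, hk.regGram_mulVec_inv_mulVec hσ, sub_add_cancel,
      dotProduct_sub, dotProduct_smul, hmean, hvar, smul_eq_mul]
    congr 1
    rw [hγ]
    field_simp
    ring
  rw [invQuad, hk.inv_mulVec_eq hσ _ hsol, dotProduct_snoc_snoc, dotProduct_sub, dotProduct_smul,
    hmean', smul_eq_mul, invQuad, hγ]
  field_simp
  ring

theorem fitQuad_snoc (hk : IsKernel k) (hσ : 0 < σ) (a : Fin n → 𝒳) (z : 𝒳) (y : Fin n → ℝ)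
    (t : ℝ) :
    fitQuad k σ (Fin.snoc a z : Fin (n + 1) → 𝒳) (Fin.snoc y t)
      = fitQuad k σ a y + t ^ 2
        - (t - postMean k σ a y z) ^ 2 / (1 + postVar k σ a z / σ ^ 2) := by
  have hv := hk.postVar_nonneg hσ a z
  rw [fitQuad, fitQuad, hk.invQuad_snoc hσ, dotProduct_snoc_snoc]
  field_simp
  ring

theorem sum_sq_div_eq_invQuad (hk : IsKernel k) (hσ : 0 < σ) (x : ℕ → 𝒳) (y : ℕ → ℝ) (n : ℕ) :
    ∑ i ∈ Finset.range n, (y i - postMean k σ (initSeg x i) (initSeg y i) (x i)) ^ 2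
        / (postVar k σ (initSeg x i) (x i) + σ ^ 2)
      = invQuad k σ (initSeg x n) (initSeg y n) := by
  induction n with
  | zero => simp [invQuad]
  | succ n ih => rw [Finset.sum_range_succ, ih, initSeg_succ, initSeg_succ, hk.invQuad_snoc hσ]

/-- Appending an observation `t` at `z` keeps `fitQuad` nonnegative; the discriminant of this
quadratic inequality in `t` bounds the posterior mean at `z`. -/
theorem postMean_sq_le (hk : IsKernel k) (hσ : 0 < σ) (a : Fin n → 𝒳) (e : Fin n → ℝ) (z : 𝒳) :
    σ ^ 2 * postMean k σ a e z ^ 2 ≤ fitQuad k σ a e * postVar k σ a z := by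
  have hv := hk.postVar_nonneg hσ a z
  set v := postVar k σ a z
  set μ := postMean k σ a e z
  set F := fitQuad k σ a e
  have hs : 0 < v + σ ^ 2 := by positivity
  have hdiscr := discrim_le_zero (a := v) (b := 2 * σ ^ 2 * μ)
    (c := F * (v + σ ^ 2) - σ ^ 2 * μ ^ 2) fun t => by
      have happend : 0 ≤ (v + σ ^ 2) * (F + t ^ 2 - (t - μ) ^ 2 / (1 + v / σ ^ 2)) := by
        rw [← hk.fitQuad_snoc hσ]
        exact mul_nonneg hs.le (hk.fitQuad_nonneg hσ _ _)
      refine happend.trans_eq ?_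
      field_simp
      ring
  rw [discrim] at hdiscr
  refine le_of_mul_le_mul_right ?_ hs
  linarith

theorem abs_postMean_le (hk : IsKernel k) (hσ : 0 < σ) (a : Fin n → 𝒳) (e : Fin n → ℝ) (z : 𝒳) :
    |postMean k σ a e z| ≤ √(fitQuad k σ a e) / σ * postStd k σ a z := by
  rw [div_mul_eq_mul_div, le_div_iff₀ hσ, postStd, ← Real.sqrt_mul (hk.fitQuad_nonneg hσ a e)]
  refine Real.le_sqrt_of_sq_le ?_
  rw [mul_pow, sq_abs, mul_comm]
  exact hk.postMean_sq_le hσ a e z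

theorem abs_sub_postMean_add_le (hk : IsKernel k) (hσ : 0 < σ) {f : 𝒳 → ℝ} {B : ℝ} (hB : 0 ≤ B)
    (hf : rkhsNorm hk f ≤ ENNReal.ofReal B) (a : Fin n → 𝒳) (e : Fin n → ℝ) (z : 𝒳) :
    |f z - postMean k σ a (fun i => f (a i) + e i) z|
      ≤ (B + √(fitQuad k σ a e) / σ) * postStd k σ a z := by
  have hsplit : f z - postMean k σ a (fun i => f (a i) + e i) z
      = (f z - postMean k σ a (fun i => f (a i)) z) - postMean k σ a e z := by
    rw [sub_sub, ← postMean_add]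
    rfl
  rw [hsplit, add_mul]
  exact (abs_sub _ _).trans
    (add_le_add (hk.abs_sub_postMean_le hσ hB hf a z) (hk.abs_postMean_le hσ a e z))

end IsKernel

end Sequential

section InfoGain

variable {𝒳 H : Type*} {k : 𝒳 → 𝒳 → ℝ} {K : H → 𝒳 → 𝒳 → ℝ} {σ : ℝ} {n : ℕ}

theorem infoGain_eq_log_det_regGram (hσ : 0 < σ) (a : Fin n → 𝒳) :
    infoGain k σ a = 1 / 2 * Real.log (((σ ^ 2)⁻¹) ^ n * (regGram k σ a).det) := by
  have hscale : 1 + (σ ^ 2)⁻¹ • gram k a = (σ ^ 2)⁻¹ • regGram k σ a := by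
    rw [regGram, smul_add, smul_smul, inv_mul_cancel₀ (by positivity), one_smul, add_comm]
  rw [infoGain, hscale, Matrix.det_smul, Fintype.card_fin]

namespace IsKernel

theorem infoGain_snoc (hk : IsKernel k) (hσ : 0 < σ) (a : Fin n → 𝒳) (z : 𝒳) :
    infoGain k σ (Fin.snoc a z : Fin (n + 1) → 𝒳)
      = infoGain k σ a + 1 / 2 * Real.log (1 + postVar k σ a z / σ ^ 2) := by
  have hv := hk.postVar_nonneg hσ a z
  have hdet := (hk.posDef_regGram hσ a).det_pos
  rw [infoGain_eq_log_det_regGram hσ, infoGain_eq_log_det_regGram hσ, hk.det_regGram_snoc hσ,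
    ← mul_add, ← Real.log_mul (by positivity) (by positivity), pow_succ]
  congr 2
  field_simp
  ring

theorem infoGain_nonneg (hk : IsKernel k) (hσ : 0 < σ) (a : Fin n → 𝒳) : 0 ≤ infoGain k σ a := by
  induction n with
  | zero => simp [infoGain]
  | succ n ih =>
    rw [← Fin.snoc_init_self a, hk.infoGain_snoc hσ]
    have hv := hk.postVar_nonneg hσ (Fin.init a) (a (Fin.last n))
    have hlog : 0 ≤ Real.log (1 + postVar k σ (Fin.init a) (a (Fin.last n)) / σ ^ 2) :=
      Real.log_nonneg (le_add_of_nonneg_right (by positivity))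
    have := ih (Fin.init a)
    positivity

theorem infoGain_le (hk : IsKernel k) (hk1 : ∀ x x', k x x' ≤ 1) (a : Fin n → 𝒳) :
    infoGain k σ a ≤ 1 / 2 * Real.log (n.factorial * (1 + (σ ^ 2)⁻¹) ^ n) := by
  have hσ : 0 ≤ (σ ^ 2)⁻¹ := by positivity
  have hpos : 0 < (1 + (σ ^ 2)⁻¹ • gram k a).det :=
    (Matrix.PosDef.one.add_posSemidef ((hk.posSemidef_gram a).smul hσ)).det_pos
  have hentry : ∀ i j, |(1 + (σ ^ 2)⁻¹ • gram k a) i j| ≤ 1 + (σ ^ 2)⁻¹ := fun i j => by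
    have hone : |(1 : Matrix (Fin n) (Fin n) ℝ) i j| ≤ 1 := by
      rw [Matrix.one_apply]; split_ifs <;> simp
    have hgram : |(σ ^ 2)⁻¹ * k (a i) (a j)| ≤ (σ ^ 2)⁻¹ := by
      rw [abs_mul, abs_of_nonneg hσ]
      exact mul_le_of_le_one_right hσ (hk.abs_le_one hk1 _ _)
    exact (abs_add_le _ _).trans (add_le_add hone hgram)
  have hdet := Matrix.det_le (abv := AbsoluteValue.abs) hentry
  rw [Fintype.card_fin, nsmul_eq_mul] at hdet
  rw [infoGain]
  gcongr
  exact (le_abs_self _).trans hdet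

end IsKernel

theorem infoGain_le_familyInfoGain (hK : ∀ θ, IsKernel (K θ)) (hK1 : ∀ θ x x', K θ x x' ≤ 1)
    (θ : H) (a : Fin n → 𝒳) : infoGain (K θ) σ a ≤ familyInfoGain K σ n := by
  have hbdd : ∀ θ (a : Fin n → 𝒳), infoGain (K θ) σ a ≤ _ := fun θ => (hK θ).infoGain_le (hK1 θ)
  have : Nonempty (Fin n → 𝒳) := ⟨a⟩
  calc infoGain (K θ) σ a ≤ maxInfoGain (K θ) σ n :=
        le_ciSup (f := fun a : Fin n → 𝒳 => infoGain (K θ) σ a)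
          ⟨_, Set.forall_mem_range.2 (hbdd θ)⟩ a
    _ ≤ familyInfoGain K σ n :=
        le_ciSup (f := fun θ => maxInfoGain (K θ) σ n)
          ⟨_, Set.forall_mem_range.2 fun θ => ciSup_le (hbdd θ)⟩ θ

theorem familyInfoGain_nonneg (hK : ∀ θ, IsKernel (K θ)) (hσ : 0 < σ) (n : ℕ) :
    0 ≤ familyInfoGain K σ n :=
  Real.iSup_nonneg fun θ => Real.iSup_nonneg fun a => (hK θ).infoGain_nonneg hσ a

end InfoGain

section Perturbation

variable {𝒳 H : Type*} {k k' : 𝒳 → 𝒳 → ℝ} {σ c : ℝ} {n : ℕ}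

theorem abs_dotProduct_mulVec_le {M : Matrix (Fin n) (Fin n) ℝ} (hM : ∀ i j, |M i j| ≤ c)
    (v w : Fin n → ℝ) : |v ⬝ᵥ (M *ᵥ w)| ≤ c * n * ((v ⬝ᵥ v + w ⬝ᵥ w) / 2) := by
  have hterm : ∀ i j, |v i * (M i j * w j)| ≤ c * ((v i ^ 2 + w j ^ 2) / 2) := fun i j => by
    rw [abs_mul, abs_mul, mul_left_comm]
    have hsq : |v i| * |w j| ≤ (v i ^ 2 + w j ^ 2) / 2 := by
      rw [← sq_abs (v i), ← sq_abs (w j)]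
      linarith [two_mul_le_add_sq |v i| |w j|]
    exact mul_le_mul (hM i j) hsq (by positivity) ((abs_nonneg _).trans (hM i j))
  calc |v ⬝ᵥ (M *ᵥ w)| ≤ ∑ i, ∑ j, c * ((v i ^ 2 + w j ^ 2) / 2) := by
        simp only [dotProduct, Matrix.mulVec, Finset.mul_sum]
        exact (Finset.abs_sum_le_sum_abs _ _).trans (Finset.sum_le_sum fun i _ =>
          (Finset.abs_sum_le_sum_abs _ _).trans (Finset.sum_le_sum fun j _ => hterm i j))
    _ = c * n * ((v ⬝ᵥ v + w ⬝ᵥ w) / 2) := by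
        simp only [← Finset.mul_sum, ← Finset.sum_div, Finset.sum_add_distrib, Finset.sum_const,
          Finset.card_univ, Fintype.card_fin, nsmul_eq_mul, dotProduct, ← sq]
        ring

theorem exists_finset_card_eq_coveringNumber {K : H → 𝒳 → 𝒳 → ℝ} {s : Finset H}
    (hs : ∀ θ, ∃ θ' ∈ s, kernelDist (K θ) (K θ') ≤ c) :
    ∃ t : Finset H, t.card = coveringNumber K c ∧ ∀ θ, ∃ θ' ∈ t, kernelDist (K θ) (K θ') ≤ c :=
  Nat.sInf_mem (s := {N : ℕ | ∃ t : Finset H, t.card = N ∧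
    ∀ θ, ∃ θ' ∈ t, kernelDist (K θ) (K θ') ≤ c}) ⟨s.card, s, rfl, hs⟩

theorem exists_finset_forall_kernelDist_le [TopologicalSpace 𝒳] [TopologicalSpace H]
    [CompactSpace 𝒳] [CompactSpace H] {K : H → 𝒳 → 𝒳 → ℝ}
    (hK : Continuous fun q : H × 𝒳 × 𝒳 => K q.1 q.2.1 q.2.2) (hc : 0 < c) :
    ∃ s : Finset H, ∀ θ, ∃ θ' ∈ s, kernelDist (K θ) (K θ') ≤ c := by
  let F : C(H, C(𝒳 × 𝒳, ℝ)) := ContinuousMap.curry ⟨fun q : H × 𝒳 × 𝒳 => K q.1 q.2.1 q.2.2, hK⟩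
  obtain ⟨s, hs⟩ := CompactSpace.elim_nhds_subcover (fun θ => F ⁻¹' Metric.ball (F θ) c)
    fun θ => F.continuous.continuousAt.preimage_mem_nhds (Metric.ball_mem_nhds _ hc)
  refine ⟨s, fun θ => ?_⟩
  obtain ⟨θ', hθ', hdist⟩ := Set.mem_iUnion₂.1 (hs.ge (Set.mem_univ θ))
  exact ⟨θ', hθ', Real.iSup_le (fun q =>
    (ContinuousMap.dist_apply_le_dist (f := F θ) (g := F θ') q).trans (Metric.mem_ball.1 hdist).le)
    hc.le⟩

namespace IsKernel

theorem abs_sub_le_kernelDist (hk : IsKernel k) (hk' : IsKernel k') (hk1 : ∀ x x', k x x' ≤ 1)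
    (hk1' : ∀ x x', k' x x' ≤ 1) (x x' : 𝒳) : |k x x' - k' x x'| ≤ kernelDist k k' :=
  le_ciSup (f := fun q : 𝒳 × 𝒳 => |k q.1 q.2 - k' q.1 q.2|) ⟨1 + 1, Set.forall_mem_range.2 fun _ =>
    (abs_sub _ _).trans (add_le_add (hk.abs_le_one hk1 _ _) (hk'.abs_le_one hk1' _ _))⟩ (x, x')

theorem inv_mulVec_dotProduct_self_le (hk : IsKernel k) (hσ : 0 < σ) (a : Fin n → 𝒳)
    (e : Fin n → ℝ) :
    ((regGram k σ a)⁻¹ *ᵥ e) ⬝ᵥ ((regGram k σ a)⁻¹ *ᵥ e) ≤ e ⬝ᵥ e / σ ^ 4 := by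
  have hAw := hk.regGram_mulVec_inv_mulVec hσ a e
  set w := (regGram k σ a)⁻¹ *ᵥ e
  have hnorm : e ⬝ᵥ e = (gram k a *ᵥ w) ⬝ᵥ (gram k a *ᵥ w) + 2 * σ ^ 2 * (w ⬝ᵥ (gram k a *ᵥ w))
      + σ ^ 4 * (w ⬝ᵥ w) := by
    rw [← hAw, regGram_mulVec]
    simp only [dotProduct_add, add_dotProduct, dotProduct_smul, smul_dotProduct, smul_eq_mul]
    rw [dotProduct_comm w]
    ring
  have := dotProduct_self_nonneg (gram k a *ᵥ w)
  have := mul_nonneg (sq_nonneg σ) (hk.dotProduct_gram_nonneg a w)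
  rw [le_div_iff₀ (by positivity), hnorm]
  linarith

theorem fitQuad_le (hk : IsKernel k) (hk1 : ∀ x x', k x x' ≤ 1) (hσ : 0 < σ) (a : Fin n → 𝒳)
    (e : Fin n → ℝ) : fitQuad k σ a e ≤ n / (n + σ ^ 2) * (e ⬝ᵥ e) := by
  have hAw := hk.regGram_mulVec_inv_mulVec hσ a e
  rw [fitQuad, invQuad]
  set w := (regGram k σ a)⁻¹ *ᵥ e
  set t : ℝ := (n + σ ^ 2)⁻¹ with ht
  have htn : t * (n + σ ^ 2) = 1 := inv_mul_cancel₀ (by positivity)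
  have hAe : e ⬝ᵥ (regGram k σ a *ᵥ e) ≤ (n + σ ^ 2) * (e ⬝ᵥ e) := by
    have hgram := (abs_le.1 (abs_dotProduct_mulVec_le
      (fun i j => hk.abs_le_one hk1 (a i) (a j)) e e (M := gram k a))).2
    rw [dotProduct_regGram_mulVec]
    linarith
  -- `(w - t e) ⬝ A (w - t e) ≥ 0` with the optimal `t = 1 / (n + σ²)`.
  have hinv : t * (e ⬝ᵥ e) ≤ e ⬝ᵥ w := by
    have hpos := (hk.posDef_regGram hσ a).posSemidef.dotProduct_mulVec_nonneg (w - t • e)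
    simp only [star_trivial, Matrix.mulVec_sub, Matrix.mulVec_smul, hAw, sub_dotProduct,
      dotProduct_sub, smul_dotProduct, dotProduct_smul, smul_eq_mul,
      dotProduct_mulVec_comm (hk.isSymm_regGram a) w e, dotProduct_comm w e] at hpos
    have hscale : t * (t * (e ⬝ᵥ (regGram k σ a *ᵥ e))) ≤ t * (e ⬝ᵥ e) :=
      calc t * (t * (e ⬝ᵥ (regGram k σ a *ᵥ e))) ≤ t * (t * ((n + σ ^ 2) * (e ⬝ᵥ e))) := by gcongr
        _ = t * (e ⬝ᵥ e) := by rw [← mul_assoc t (n + σ ^ 2), htn, one_mul]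
    linarith
  calc e ⬝ᵥ e - σ ^ 2 * (e ⬝ᵥ w) ≤ e ⬝ᵥ e - σ ^ 2 * (t * (e ⬝ᵥ e)) := by gcongr
    _ = n / (n + σ ^ 2) * (e ⬝ᵥ e) := by
        rw [ht]
        field_simp
        ring

theorem fitQuad_le_add (hk : IsKernel k) (hk' : IsKernel k') (hσ : 0 < σ) (hc : 0 ≤ c)
    (hdist : ∀ x x', |k x x' - k' x x'| ≤ c) (a : Fin n → 𝒳) (e : Fin n → ℝ) :
    fitQuad k σ a e ≤ fitQuad k' σ a e + c * n * (e ⬝ᵥ e) / σ ^ 2 := by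
  have hAw := hk.regGram_mulVec_inv_mulVec hσ a e
  have hAw' := hk'.regGram_mulVec_inv_mulVec hσ a e
  have hw := hk.inv_mulVec_dotProduct_self_le hσ a e
  have hw' := hk'.inv_mulVec_dotProduct_self_le hσ a e
  rw [fitQuad, fitQuad, invQuad, invQuad]
  set w := (regGram k σ a)⁻¹ *ᵥ e
  set w' := (regGram k' σ a)⁻¹ *ᵥ e
  have hresolvent : e ⬝ᵥ w' - e ⬝ᵥ w = w ⬝ᵥ ((gram k a - gram k' a) *ᵥ w') := by
    have h : e ⬝ᵥ w' = w ⬝ᵥ (regGram k σ a *ᵥ w') := by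
      rw [dotProduct_mulVec_comm (hk.isSymm_regGram a), hAw, dotProduct_comm]
    have h' : e ⬝ᵥ w = w ⬝ᵥ (regGram k' σ a *ᵥ w') := by rw [hAw', dotProduct_comm]
    rw [h, h', dotProduct_regGram_mulVec, dotProduct_regGram_mulVec, Matrix.sub_mulVec,
      dotProduct_sub]
    ring
  have hdiff : e ⬝ᵥ w' - e ⬝ᵥ w ≤ c * n * (e ⬝ᵥ e / σ ^ 4) :=
    calc e ⬝ᵥ w' - e ⬝ᵥ w ≤ c * n * ((w ⬝ᵥ w + w' ⬝ᵥ w') / 2) :=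
          hresolvent.trans_le (le_of_abs_le (abs_dotProduct_mulVec_le
            (fun i j => hdist (a i) (a j)) w w'))
      _ ≤ c * n * (e ⬝ᵥ e / σ ^ 4) :=
          mul_le_mul_of_nonneg_left (by linarith) (by positivity)
  calc e ⬝ᵥ e - σ ^ 2 * (e ⬝ᵥ w)
      = e ⬝ᵥ e - σ ^ 2 * (e ⬝ᵥ w') + σ ^ 2 * (e ⬝ᵥ w' - e ⬝ᵥ w) := by ring
    _ ≤ e ⬝ᵥ e - σ ^ 2 * (e ⬝ᵥ w') + σ ^ 2 * (c * n * (e ⬝ᵥ e / σ ^ 4)) := by gcongr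
    _ = e ⬝ᵥ e - σ ^ 2 * (e ⬝ᵥ w') + c * n * (e ⬝ᵥ e) / σ ^ 2 := by field_simp

end IsKernel

end Perturbation

section Supermartingale

variable {Ω : Type*} {m₀ mΩ : MeasurableSpace Ω} {P : Measure Ω}

theorem lintegral_mul_le_of_condExp_le [IsFiniteMeasure P] (hm₀ : m₀ ≤ mΩ) {F : Ω → ℝ}
    (hF : Integrable F P) (hF0 : 0 ≤ F) {c : ℝ} (hle : P[F | m₀] ≤ᵐ[P] fun _ => c)
    {g : Ω → ℝ≥0∞} (hg : Measurable[m₀] g) :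
    ∫⁻ ω, g ω * ENNReal.ofReal (F ω) ∂P ≤ ENNReal.ofReal c * ∫⁻ ω, g ω ∂P := by
  set ν := P.withDensity fun ω => ENNReal.ofReal (F ω)
  have hset : ∀ s, MeasurableSet[m₀] s → ν s ≤ ENNReal.ofReal c * P s := fun s hs =>
    calc ν s = ENNReal.ofReal (∫ ω in s, (P[F | m₀]) ω ∂P) := by
          rw [withDensity_apply _ (hm₀ s hs), setIntegral_condExp hm₀ hF hs,
            ofReal_integral_eq_lintegral_ofReal hF.restrict (ae_of_all _ hF0)]
      _ ≤ ENNReal.ofReal (∫ _ in s, c ∂P) :=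
          ENNReal.ofReal_le_ofReal (integral_mono_ae integrable_condExp.restrict
            (integrable_const c) (ae_restrict_of_ae hle))
      _ = ENNReal.ofReal c * P s := by
          rw [setIntegral_const, smul_eq_mul, ENNReal.ofReal_mul measureReal_nonneg, mul_comm,
            ofReal_measureReal]
  have htrim : ν.trim hm₀ ≤ ENNReal.ofReal c • P.trim hm₀ := Measure.le_iff.2 fun s hs => by
    rw [Measure.smul_apply, trim_measurableSet_eq hm₀ hs, trim_measurableSet_eq hm₀ hs]
    exact hset s hs
  calc ∫⁻ ω, g ω * ENNReal.ofReal (F ω) ∂P = ∫⁻ ω, g ω ∂ν := by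
        rw [lintegral_withDensity_eq_lintegral_mul₀ hF.aemeasurable.ennreal_ofReal
          (hg.mono hm₀ le_rfl).aemeasurable]
        simp only [Pi.mul_apply, mul_comm]
    _ = ∫⁻ ω, g ω ∂ν.trim hm₀ := (lintegral_trim hm₀ hg).symm
    _ ≤ ∫⁻ ω, g ω ∂(ENNReal.ofReal c • P.trim hm₀) := lintegral_mono' htrim le_rfl
    _ = ENNReal.ofReal c * ∫⁻ ω, g ω ∂P := by
        rw [lintegral_smul_measure, lintegral_trim hm₀ hg, smul_eq_mul]

theorem lintegral_mul_simpleFunc_comp_le {β : Type*} (hm₀ : m₀ ≤ mΩ) {F : β → Ω → ℝ≥0∞}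
    (hFm : ∀ b, Measurable (F b))
    (hF : ∀ b, ∀ g : Ω → ℝ≥0∞, Measurable[m₀] g → ∫⁻ ω, g ω * F b ω ∂P ≤ ∫⁻ ω, g ω ∂P)
    (h : SimpleFunc Ω β) (hfiber : ∀ b, MeasurableSet[m₀] (h ⁻¹' {b})) {g : Ω → ℝ≥0∞}
    (hg : Measurable[m₀] g) :
    ∫⁻ ω, g ω * F (h ω) ω ∂P ≤ ∫⁻ ω, g ω ∂P := by
  have hsplit : ∀ u : Ω → ℝ≥0∞, ∀ ω, u ω = ∑ b ∈ h.range, (h ⁻¹' {b}).indicator u ω := fun u ω => by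
    rw [Finset.sum_eq_single_of_mem (h ω) (h.mem_range_self ω) fun b _ hb =>
      Set.indicator_of_notMem (fun hω => hb hω.symm) u]
    exact (Set.indicator_of_mem (show ω ∈ h ⁻¹' {h ω} from rfl) u).symm
  calc ∫⁻ ω, g ω * F (h ω) ω ∂P
      = ∫⁻ ω, ∑ b ∈ h.range, (h ⁻¹' {b}).indicator g ω * F b ω ∂P := by
        refine lintegral_congr fun ω => (hsplit (fun ω => g ω * F (h ω) ω) ω).trans
          (Finset.sum_congr rfl fun b _ => ?_)
        by_cases hω : h ω = b <;> simp [hω]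
    _ = ∑ b ∈ h.range, ∫⁻ ω, (h ⁻¹' {b}).indicator g ω * F b ω ∂P :=
        lintegral_finsetSum _ fun b _ => ((hg.indicator (hfiber b)).mono hm₀ le_rfl).mul (hFm b)
    _ ≤ ∑ b ∈ h.range, ∫⁻ ω, (h ⁻¹' {b}).indicator g ω ∂P :=
        Finset.sum_le_sum fun b _ => hF b _ (hg.indicator (hfiber b))
    _ = ∫⁻ ω, g ω ∂P := by
        rw [← lintegral_finsetSum _ fun b _ => (hg.indicator (hfiber b)).mono hm₀ le_rfl]
        exact lintegral_congr fun ω => (hsplit g ω).symm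

theorem lintegral_mul_comp_le {β : Type*} [TopologicalSpace β] (hm₀ : m₀ ≤ mΩ)
    {F : β → Ω → ℝ≥0∞} (hFm : ∀ b, Measurable (F b)) (hFc : ∀ ω, Continuous fun b => F b ω)
    (hF : ∀ b, ∀ g : Ω → ℝ≥0∞, Measurable[m₀] g → ∫⁻ ω, g ω * F b ω ∂P ≤ ∫⁻ ω, g ω ∂P)
    {h : Ω → β} (hh : StronglyMeasurable[m₀] h) {g : Ω → ℝ≥0∞} (hg : Measurable[m₀] g) :
    ∫⁻ ω, g ω * F (h ω) ω ∂P ≤ ∫⁻ ω, g ω ∂P := by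
  have hfiber : ∀ j b, MeasurableSet[m₀] (hh.approx j ⁻¹' {b}) := fun j =>
    @SimpleFunc.measurableSet_fiber _ _ m₀ (hh.approx j)
  let u : ℕ → SimpleFunc Ω β := fun j =>
    ⟨hh.approx j, fun b => hm₀ _ (hfiber j b), @SimpleFunc.finite_range _ _ m₀ (hh.approx j)⟩
  have hmeas : ∀ j, Measurable fun ω => g ω * F (u j ω) ω := fun j =>
    (hg.mono hm₀ le_rfl).mul ((u j).measurable_bind F hFm)
  calc ∫⁻ ω, g ω * F (h ω) ω ∂P
      ≤ ∫⁻ ω, Filter.liminf (fun j => g ω * F (u j ω) ω) Filter.atTop ∂P := by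
        refine lintegral_mono fun ω => ?_
        have hlim : Filter.Tendsto (fun j => F (u j ω) ω) Filter.atTop (nhds (F (h ω) ω)) :=
          ((hFc ω).tendsto (h ω)).comp (hh.tendsto_approx ω)
        have hle := ENNReal.le_liminf_mul (u := fun _ : ℕ => g ω)
          (v := fun j => F (u j ω) ω) (f := Filter.atTop)
        rwa [Filter.liminf_const, hlim.liminf_eq] at hle
    _ ≤ Filter.liminf (fun j => ∫⁻ ω, g ω * F (u j ω) ω ∂P) Filter.atTop :=
        lintegral_liminf_le hmeas
    _ ≤ ∫⁻ ω, g ω ∂P :=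
        Filter.liminf_le_of_le (by isBoundedDefault) fun c hc => by
          obtain ⟨j, hj⟩ := hc.exists
          exact hj.trans (lintegral_mul_simpleFunc_comp_le hm₀ hFm hF (u j) (hfiber j) hg)

theorem mul_measure_exists_le_prod_le {ℱ : Filtration ℕ mΩ} {F : ℕ → Ω → ℝ≥0∞} {T : ℕ}
    (hFm : ∀ n < T, Measurable[ℱ (n + 1)] (F n))
    (hF : ∀ n < T, ∀ g : Ω → ℝ≥0∞, Measurable[ℱ n] g →
      ∫⁻ ω, g ω * F n ω ∂P ≤ ∫⁻ ω, g ω ∂P) (c : ℝ≥0∞) {n r : ℕ} (hn : n + r ≤ T)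
    {g : Ω → ℝ≥0∞} (hg : Measurable[ℱ n] g) :
    c * P {ω | ∃ j ≤ r, c ≤ g ω * ∏ i ∈ Finset.range j, F (n + i) ω} ≤ ∫⁻ ω, g ω ∂P := by
  induction r generalizing n g with
  | zero => simpa using mul_meas_ge_le_lintegral (hg.mono (ℱ.le n) le_rfl) c
  | succ r ih =>
    set A := {ω | c ≤ g ω}
    have hA : MeasurableSet[ℱ n] A := measurableSet_le measurable_const hg
    have hAΩ : MeasurableSet A := ℱ.le n _ hA
    have hgc : Measurable[ℱ n] (Aᶜ.indicator g) := hg.indicator hA.compl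
    have hnext := ih (by omega) ((hgc.mono (ℱ.mono n.le_succ) le_rfl).mul (hFm n (by omega)))
    set D := {ω | ∃ j ≤ r, c ≤ Aᶜ.indicator g ω * F n ω
      * ∏ i ∈ Finset.range j, F (n + 1 + i) ω}
    have hsub : {ω | ∃ j ≤ r + 1, c ≤ g ω * ∏ i ∈ Finset.range j, F (n + i) ω} ⊆ A ∪ D := by
      rintro ω ⟨j, hj, hcj⟩
      by_cases hωA : ω ∈ A
      · exact Or.inl hωA
      rcases j with _ | j
      · simp only [Finset.range_zero, Finset.prod_empty, mul_one] at hcj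
        exact absurd hcj hωA
      · refine Or.inr ⟨j, by omega, hcj.trans_eq ?_⟩
        rw [Set.indicator_of_mem (show ω ∈ Aᶜ from hωA), Finset.prod_range_succ', mul_assoc,
          mul_comm (F n ω)]
        simp only [add_zero, add_assoc, add_comm 1]
    calc c * P {ω | ∃ j ≤ r + 1, c ≤ g ω * ∏ i ∈ Finset.range j, F (n + i) ω}
        ≤ c * P A + c * P D := by
          rw [← mul_add]
          gcongr
          exact (measure_mono hsub).trans (measure_union_le _ _)
      _ ≤ ∫⁻ ω in A, g ω ∂P + ∫⁻ ω, Aᶜ.indicator g ω ∂P := by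
          refine add_le_add ?_ (hnext.trans (hF n (by omega) _ hgc))
          rw [← setLIntegral_const]
          exact setLIntegral_mono (hg.mono (ℱ.le n) le_rfl) fun ω hω => hω
      _ = ∫⁻ ω, g ω ∂P := by rw [lintegral_indicator hAΩ.compl, lintegral_add_compl _ hAΩ]

end Supermartingale

section Mixture

/-- The likelihood ratio `N(m, 1 + v) / N(0, 1)` at `e`, equivalently the mean over `h ∼ N(m, v)`
of the exponential tilts `exp (h e - h ^ 2 / 2)`: one step of the method of mixtures. -/
def mixFactor (e m v : ℝ) : ℝ :=
  Real.exp ((e ^ 2 - (e - m) ^ 2 / (1 + v)) / 2 - Real.log (1 + v) / 2)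

theorem mixFactor_nonneg (e m v : ℝ) : 0 ≤ mixFactor e m v := (Real.exp_pos _).le

theorem measurable_mixFactor {Ω : Type*} {_ : MeasurableSpace Ω} {e m v : Ω → ℝ}
    (he : Measurable e) (hm : Measurable m) (hv : Measurable v) :
    Measurable fun ω => mixFactor (e ω) (m ω) (v ω) := by
  unfold mixFactor
  fun_prop

theorem IsKernel.prod_mixFactor {𝒳 : Type*} {k : 𝒳 → 𝒳 → ℝ} (hk : IsKernel k) {σ : ℝ}
    (hσ : 0 < σ) (x : ℕ → 𝒳) (e : ℕ → ℝ) (n : ℕ) :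
    ∏ i ∈ Finset.range n, mixFactor (e i) (postMean k σ (initSeg x i) (initSeg e i) (x i))
        (postVar k σ (initSeg x i) (x i) / σ ^ 2)
      = Real.exp (fitQuad k σ (initSeg x n) (initSeg e n) / 2 - infoGain k σ (initSeg x n)) := by
  induction n with
  | zero => simp [fitQuad, invQuad, infoGain]
  | succ n ih =>
    rw [Finset.prod_range_succ, ih, initSeg_succ, initSeg_succ, hk.fitQuad_snoc hσ,
      hk.infoGain_snoc hσ, mixFactor, ← Real.exp_add]
    ring_nf

theorem gaussianPDFReal_mul_exp_tilt (e m : ℝ) {v : ℝ} (hv : 0 ≤ v) (z : ℝ) :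
    gaussianPDFReal 0 1 z * Real.exp ((m + √v * z) * e - (m + √v * z) ^ 2 / 2)
      = mixFactor e m v
        * gaussianPDFReal (√v * (e - m) / (1 + v)) (1 + v).toNNReal⁻¹ z := by
  have hv1 : 0 < 1 + v := by positivity
  have hlog : Real.exp (Real.log (1 + v) / 2) = √(1 + v) := by
    rw [Real.sqrt_eq_rpow, Real.rpow_def_of_pos hv1]
    ring_nf
  have hexponent : -(z - 0) ^ 2 / (2 * 1) + ((m + √v * z) * e - (m + √v * z) ^ 2 / 2)
      = (e ^ 2 - (e - m) ^ 2 / (1 + v)) / 2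
        + -(z - √v * (e - m) / (1 + v)) ^ 2 / (2 * (1 + v)⁻¹) := by
    obtain ⟨s, rfl⟩ : ∃ s, v = s ^ 2 := ⟨√v, (Real.sq_sqrt hv).symm⟩
    rw [Real.sqrt_sq_eq_abs]
    field_simp
    rcases abs_choice s with h | h <;> rw [h] <;> ring
  rw [gaussianPDFReal, gaussianPDFReal, mixFactor, NNReal.coe_inv, Real.coe_toNNReal _ hv1.le,
    NNReal.coe_one, mul_assoc, ← Real.exp_add, hexponent, Real.exp_add, Real.exp_sub, hlog,
    mul_one, Real.sqrt_mul' _ (inv_nonneg.2 hv1.le), Real.sqrt_inv]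
  field_simp

theorem lintegral_exp_tilt_gaussianReal (e m : ℝ) {v : ℝ} (hv : 0 ≤ v) :
    ∫⁻ z, ENNReal.ofReal (Real.exp ((m + √v * z) * e - (m + √v * z) ^ 2 / 2)) ∂gaussianReal 0 1
      = ENNReal.ofReal (mixFactor e m v) := by
  have hv1 : (1 + v).toNNReal⁻¹ ≠ 0 :=
    inv_ne_zero (Real.toNNReal_pos.2 (by positivity)).ne'
  rw [gaussianReal_of_var_ne_zero _ one_ne_zero, lintegral_withDensity_eq_lintegral_mul _
    (measurable_gaussianPDF _ _) (by fun_prop)]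
  calc _ = ∫⁻ z, ENNReal.ofReal (mixFactor e m v)
        * gaussianPDF (√v * (e - m) / (1 + v)) (1 + v).toNNReal⁻¹ z := by
        refine lintegral_congr fun z => ?_
        rw [Pi.mul_apply, gaussianPDF, gaussianPDF,
          ← ENNReal.ofReal_mul (gaussianPDFReal_nonneg _ _ _), gaussianPDFReal_mul_exp_tilt e m hv,
          ENNReal.ofReal_mul (mixFactor_nonneg e m v)]
    _ = ENNReal.ofReal (mixFactor e m v) := by
        rw [lintegral_const_mul _ (measurable_gaussianPDF _ _), lintegral_gaussianPDF_eq_one _ hv1,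
          mul_one]

variable {Ω : Type*} {m₀ mΩ : MeasurableSpace Ω} {P : Measure Ω} [IsFiniteMeasure P] {e : Ω → ℝ}

theorem lintegral_mul_exp_tilt_le (hm₀ : m₀ ≤ mΩ) {η : ℝ}
    (hint : Integrable (fun ω => Real.exp (η * e ω)) P)
    (hsub : P[fun ω => Real.exp (η * e ω) | m₀] ≤ᵐ[P] fun _ => Real.exp (η ^ 2 / 2))
    {g : Ω → ℝ≥0∞} (hg : Measurable[m₀] g) :
    ∫⁻ ω, g ω * ENNReal.ofReal (Real.exp (η * e ω - η ^ 2 / 2)) ∂P ≤ ∫⁻ ω, g ω ∂P := by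
  have hc :
      ENNReal.ofReal (Real.exp (η ^ 2 / 2)) * ENNReal.ofReal (Real.exp (-(η ^ 2 / 2))) = 1 := by
    rw [← ENNReal.ofReal_mul (Real.exp_pos _).le, ← Real.exp_add, add_neg_cancel, Real.exp_zero,
      ENNReal.ofReal_one]
  calc ∫⁻ ω, g ω * ENNReal.ofReal (Real.exp (η * e ω - η ^ 2 / 2)) ∂P
      = ∫⁻ ω, (g ω * ENNReal.ofReal (Real.exp (-(η ^ 2 / 2))))
          * ENNReal.ofReal (Real.exp (η * e ω)) ∂P := by
        refine lintegral_congr fun ω => ?_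
        rw [sub_eq_neg_add, Real.exp_add, ENNReal.ofReal_mul (Real.exp_pos _).le, mul_assoc]
    _ ≤ ENNReal.ofReal (Real.exp (η ^ 2 / 2))
          * ∫⁻ ω, g ω * ENNReal.ofReal (Real.exp (-(η ^ 2 / 2))) ∂P :=
        lintegral_mul_le_of_condExp_le hm₀ hint (fun ω => (Real.exp_pos _).le) hsub
          (hg.mul_const _)
    _ = ∫⁻ ω, g ω ∂P := by
        rw [lintegral_mul_const _ (hg.mono hm₀ le_rfl), mul_left_comm, hc, mul_one]

theorem lintegral_mul_mixFactor_le (hm₀ : m₀ ≤ mΩ) (he : Measurable e)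
    (hsub : ∀ η : ℝ, Integrable (fun ω => Real.exp (η * e ω)) P ∧
      P[fun ω => Real.exp (η * e ω) | m₀] ≤ᵐ[P] fun _ => Real.exp (η ^ 2 / 2))
    {m v : Ω → ℝ} (hm : Measurable[m₀] m) (hv : Measurable[m₀] v) (hv0 : ∀ ω, 0 ≤ v ω)
    {g : Ω → ℝ≥0∞} (hg : Measurable[m₀] g) :
    ∫⁻ ω, g ω * ENNReal.ofReal (mixFactor (e ω) (m ω) (v ω)) ∂P ≤ ∫⁻ ω, g ω ∂P := by
  let tilt : ℝ → Ω → ℝ≥0∞ := fun η ω => ENNReal.ofReal (Real.exp (η * e ω - η ^ 2 / 2))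
  have htilt : Measurable fun q : ℝ × Ω => tilt q.1 q.2 := by fun_prop
  have hpredictable : ∀ z : ℝ, ∫⁻ ω, g ω * tilt (m ω + √(v ω) * z) ω ∂P ≤ ∫⁻ ω, g ω ∂P := fun z =>
    lintegral_mul_comp_le (h := fun ω => m ω + √(v ω) * z) hm₀ (fun η => by fun_prop)
      (fun ω => ENNReal.continuous_ofReal.comp (by fun_prop))
      (fun η g hg => lintegral_mul_exp_tilt_le hm₀ (hsub η).1 (hsub η).2 hg)
      (hm.add (hv.sqrt.mul_const z)).stronglyMeasurable hg
  have hgΩ := hg.mono hm₀ le_rfl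
  have hmΩ := hm.mono hm₀ le_rfl
  have hvΩ := hv.mono hm₀ le_rfl
  calc ∫⁻ ω, g ω * ENNReal.ofReal (mixFactor (e ω) (m ω) (v ω)) ∂P
      = ∫⁻ ω, ∫⁻ z, g ω * tilt (m ω + √(v ω) * z) ω ∂gaussianReal 0 1 ∂P :=
        lintegral_congr fun ω => by
          rw [lintegral_const_mul _ (by fun_prop), lintegral_exp_tilt_gaussianReal _ _ (hv0 ω)]
    _ = ∫⁻ z, ∫⁻ ω, g ω * tilt (m ω + √(v ω) * z) ω ∂P ∂gaussianReal 0 1 :=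
        lintegral_lintegral_swap (by fun_prop)
    _ ≤ ∫⁻ _ : ℝ, ∫⁻ ω, g ω ∂P ∂gaussianReal 0 1 := lintegral_mono hpredictable
    _ = ∫⁻ ω, g ω ∂P := by rw [lintegral_const, measure_univ, mul_one]

end Mixture

section Measurability

variable {Ω : Type*} {_ : MeasurableSpace Ω} {n : ℕ}

theorem measurable_matrix_det {M : Ω → Matrix (Fin n) (Fin n) ℝ}
    (hM : ∀ i j, Measurable fun ω => M ω i j) : Measurable fun ω => (M ω).det := by
  simp only [Matrix.det_apply']
  fun_prop

theorem measurable_matrix_inv_apply {M : Ω → Matrix (Fin n) (Fin n) ℝ}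
    (hM : ∀ i j, Measurable fun ω => M ω i j) (i j : Fin n) :
    Measurable fun ω => (M ω)⁻¹ i j := by
  simp only [Matrix.inv_def, Matrix.smul_apply, Ring.inverse_eq_inv', smul_eq_mul,
    Matrix.adjugate_apply]
  refine (measurable_matrix_det hM).inv.mul (measurable_matrix_det fun i' j' => ?_)
  by_cases hij : i' = j
  · subst hij
    simp only [Matrix.updateRow_self, measurable_const]
  · simpa only [Matrix.updateRow_ne hij] using hM i' j'

variable {𝒳 : Type*} [MeasurableSpace 𝒳] {k : 𝒳 → 𝒳 → ℝ} {σ : ℝ} {a : Fin n → Ω → 𝒳}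
  {y : Fin n → Ω → ℝ} {z : Ω → 𝒳}

theorem measurable_postMean (hk : Measurable (Function.uncurry k)) (ha : ∀ i, Measurable (a i))
    (hy : ∀ i, Measurable (y i)) (hz : Measurable z) :
    Measurable fun ω => postMean k σ (fun i => a i ω) (fun i => y i ω) (z ω) := by
  have hcomp : ∀ {u w : Ω → 𝒳}, Measurable u → Measurable w → Measurable fun ω => k (u ω) (w ω) :=
    fun hu hw => hk.comp (hu.prodMk hw)
  have hinv : ∀ i j, Measurable fun ω => (regGram k σ fun i => a i ω)⁻¹ i j :=
    measurable_matrix_inv_apply fun i j => (hcomp (ha i) (ha j)).add_const _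
  simp only [postMean_eq, dotProduct, Matrix.mulVec, kvec]
  exact Finset.measurable_fun_sum _ fun i _ => (hcomp (ha i) hz).mul
    (Finset.measurable_fun_sum _ fun j _ => (hinv i j).mul (hy j))

theorem measurable_postVar (hk : Measurable (Function.uncurry k)) (ha : ∀ i, Measurable (a i))
    (hz : Measurable z) : Measurable fun ω => postVar k σ (fun i => a i ω) (z ω) := by
  simp only [postVar_eq]
  exact (hk.comp (hz.prodMk hz)).sub
    (measurable_postMean hk ha (fun i => hk.comp ((ha i).prodMk hz)) hz)

end Measurability

section Concentration

variable {Ω : Type*} {mΩ : MeasurableSpace Ω} {P : Measure Ω} {ℱ : Filtration ℕ mΩ}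
  {ξ : ℕ → Ω → ℝ} {T : ℕ}

theorem CondSubGaussian.div {R : ℝ} (hR : 0 < R) (hξ : CondSubGaussian P ℱ ξ R T) :
    CondSubGaussian P ℱ (fun n ω => ξ n ω / R) 1 T := by
  intro n hn η
  have hscale : (fun ω => Real.exp (η * (ξ n ω / R))) = fun ω => Real.exp (η / R * ξ n ω) := by
    funext ω
    ring_nf
  have hvar : η ^ 2 * 1 ^ 2 / 2 = (η / R) ^ 2 * R ^ 2 / 2 := by field_simp
  rw [hscale, hvar]
  exact hξ n hn (η / R)

variable [IsProbabilityMeasure P]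

theorem measure_exists_le_prod_mixFactor_le (hξm : ∀ n < T, Measurable[ℱ (n + 1)] (ξ n))
    (hξ : CondSubGaussian P ℱ ξ 1 T) {m v : ℕ → Ω → ℝ} (hm : ∀ n < T, Measurable[ℱ n] (m n))
    (hv : ∀ n < T, Measurable[ℱ n] (v n)) (hv0 : ∀ n ω, 0 ≤ v n ω) {δ : ℝ} (hδ : 0 < δ) :
    P {ω | ∃ n ≤ T, δ⁻¹ ≤ ∏ i ∈ Finset.range n, mixFactor (ξ i ω) (m i ω) (v i ω)}
      ≤ ENNReal.ofReal δ := by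
  have hville := mul_measure_exists_le_prod_le (P := P) (ℱ := ℱ) (n := 0) (r := T)
    (F := fun n ω => ENNReal.ofReal (mixFactor (ξ n ω) (m n ω) (v n ω)))
    (fun n hn => (measurable_mixFactor (hξm n hn) ((hm n hn).mono (ℱ.mono n.le_succ) le_rfl)
      ((hv n hn).mono (ℱ.mono n.le_succ) le_rfl)).ennreal_ofReal)
    (fun n hn g hg => lintegral_mul_mixFactor_le (ℱ.le n) ((hξm n hn).mono (ℱ.le _) le_rfl)
      (fun η => by simpa only [one_pow, mul_one] using hξ n hn η) (hm n hn) (hv n hn) (hv0 n) hg)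
    (ENNReal.ofReal δ⁻¹) (zero_add T).le (g := fun _ => 1) measurable_const
  simp only [zero_add, one_mul, lintegral_const, measure_univ,
    ← ENNReal.ofReal_prod_of_nonneg fun _ _ => mixFactor_nonneg _ _ _,
    ENNReal.ofReal_le_ofReal_iff (Finset.prod_nonneg fun _ _ => mixFactor_nonneg _ _ _),
    mul_comm (ENNReal.ofReal δ⁻¹)] at hville
  simpa only [ENNReal.ofReal_inv_of_pos hδ, inv_inv] using ENNReal.le_inv_iff_mul_le.2 hville

theorem IsKernel.measure_exists_le_fitQuad_le {𝒳 : Type*} [MeasurableSpace 𝒳] {k : 𝒳 → 𝒳 → ℝ}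
    (hk : IsKernel k) (hkm : Measurable (Function.uncurry k)) {σ : ℝ} (hσ : 0 < σ)
    {x : ℕ → Ω → 𝒳} (hx : ∀ n < T, Measurable[ℱ n] (x n))
    (hξm : ∀ n < T, Measurable[ℱ (n + 1)] (ξ n)) (hξ : CondSubGaussian P ℱ ξ 1 T)
    {δ : ℝ} (hδ : 0 < δ) :
    P {ω | ∃ n ≤ T, 2 * (infoGain k σ (initSeg (x · ω) n) + Real.log δ⁻¹)
        ≤ fitQuad k σ (initSeg (x · ω) n) (initSeg (ξ · ω) n)} ≤ ENNReal.ofReal δ := by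
  have hxm : ∀ n < T, ∀ i ≤ n, Measurable[ℱ n] (x i) := fun n hn i hi =>
    (hx i (by omega)).mono (ℱ.mono hi) le_rfl
  refine le_of_eq_of_le (congrArg P (Set.ext fun ω => exists_congr fun n =>
    and_congr_right fun _ => ?_)) (measure_exists_le_prod_mixFactor_le hξm hξ
      (m := fun n ω => postMean k σ (initSeg (x · ω) n) (initSeg (ξ · ω) n) (x n ω))
      (v := fun n ω => postVar k σ (initSeg (x · ω) n) (x n ω) / σ ^ 2)
      (fun n hn => measurable_postMean hkm (fun i => hxm n hn i i.2.le)
        (fun i => (hξm i (i.2.trans hn)).mono (ℱ.mono i.2) le_rfl) (hxm n hn n le_rfl))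
      (fun n hn => (measurable_postVar hkm (fun i => hxm n hn i i.2.le)
        (hxm n hn n le_rfl)).div_const _)
      (fun n ω => div_nonneg (hk.postVar_nonneg hσ _ _) (sq_nonneg σ)) hδ)
  rw [hk.prod_mixFactor hσ (x · ω) (ξ · ω) n, ← Real.log_le_iff_le_exp (inv_pos.2 hδ)]
  constructor <;> intro h <;> linarith

theorem measure_exists_mem_finset_le_fitQuad_le {𝒳 H : Type*} [MeasurableSpace 𝒳]
    {K : H → 𝒳 → 𝒳 → ℝ} (hK : ∀ θ, IsKernel (K θ))
    (hKm : ∀ θ, Measurable (Function.uncurry (K θ))) {σ : ℝ} (hσ : 0 < σ) {x : ℕ → Ω → 𝒳}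
    (hx : ∀ n < T, Measurable[ℱ n] (x n)) (hξm : ∀ n < T, Measurable[ℱ (n + 1)] (ξ n))
    (hξ : CondSubGaussian P ℱ ξ 1 T) {δ : ℝ} (hδ : 0 < δ) {s : Finset H} (hs : s.Nonempty) :
    P {ω | ∃ θ ∈ s, ∃ n ≤ T, 2 * (infoGain (K θ) σ (initSeg (x · ω) n) + Real.log (s.card / δ))
        ≤ fitQuad (K θ) σ (initSeg (x · ω) n) (initSeg (ξ · ω) n)} ≤ ENNReal.ofReal δ := by
  have hcard : (0 : ℝ) < s.card := by exact_mod_cast hs.card_pos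
  set fit : H → Set Ω := fun θ => {ω | ∃ n ≤ T,
    2 * (infoGain (K θ) σ (initSeg (x · ω) n) + Real.log (δ / s.card)⁻¹)
      ≤ fitQuad (K θ) σ (initSeg (x · ω) n) (initSeg (ξ · ω) n)}
  calc _ = P (⋃ θ ∈ s, fit θ) := by
        congr 1
        ext ω
        simp only [fit, inv_div, Set.mem_iUnion, Set.mem_ofPred_eq, exists_prop]
    _ ≤ ∑ θ ∈ s, P (fit θ) := measure_biUnion_finset_le s fit
    _ ≤ ∑ _θ ∈ s, ENNReal.ofReal (δ / s.card) := Finset.sum_le_sum fun θ _ =>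
        (hK θ).measure_exists_le_fitQuad_le (hKm θ) hσ hx hξm hξ (by positivity)
    _ = ENNReal.ofReal δ := by
        rw [Finset.sum_const, nsmul_eq_mul, ← ENNReal.ofReal_natCast,
          ← ENNReal.ofReal_mul hcard.le, mul_div_cancel₀ _ hcard.ne']

theorem measure_exists_le_sum_sq_le (hξm : ∀ n < T, Measurable[ℱ (n + 1)] (ξ n))
    (hξ : CondSubGaussian P ℱ ξ 1 T) {v : ℝ} (hv : 0 ≤ v) {δ : ℝ} (hδ : 0 < δ) :
    P {ω | ∃ n ≤ T, Real.log δ⁻¹ + n * (Real.log (1 + v) / 2)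
        ≤ v / (1 + v) / 2 * ∑ i ∈ Finset.range n, ξ i ω ^ 2} ≤ ENNReal.ofReal δ := by
  have hv1 : 1 + v ≠ 0 := by positivity
  have hfactor : ∀ e, mixFactor e 0 v
      = Real.exp (v / (1 + v) / 2 * e ^ 2 - Real.log (1 + v) / 2) := fun e => by
    rw [mixFactor]
    congr 2
    field_simp
    ring
  refine le_of_eq_of_le (congrArg P (Set.ext fun ω => exists_congr fun n =>
    and_congr_right fun _ => ?_)) (measure_exists_le_prod_mixFactor_le hξm hξ
      (m := fun _ _ => 0) (v := fun _ _ => v) (fun _ _ => measurable_const)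
      (fun _ _ => measurable_const) (fun _ _ => hv) hδ)
  simp only [hfactor]
  rw [← Real.exp_sum, ← Real.log_le_iff_le_exp (inv_pos.2 hδ), Finset.sum_sub_distrib,
    ← Finset.mul_sum, Finset.sum_const, Finset.card_range, nsmul_eq_mul, le_sub_iff_add_le]

end Concentration

section NoiseControlled

variable {𝒳 H : Type*}

/-- The deterministic properties of the queries `x` and of the normalized noise `ξ` on which both
claims of the theorem rest: `fit_le` bounds the noise terms of the kernels in a finite net `s`, and
`energy_le` and `total_le` bound the energy of the noise, uniformly in time for the step from the
net to the whole family and over all rounds for the feasibility margin. -/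
structure NoiseControlled (K : H → 𝒳 → 𝒳 → ℝ) (σ δ : ℝ) (T : ℕ) (s : Finset H) (x : ℕ → 𝒳)
    (ξ : ℕ → ℝ) : Prop where
  fit_le : ∀ θ ∈ s, ∀ n ≤ T, fitQuad (K θ) σ (initSeg x n) (initSeg ξ n)
    ≤ 2 * (infoGain (K θ) σ (initSeg x n) + Real.log (6 * s.card / δ))
  energy_le : ∀ n ≤ T, (2 * T - 1) / (2 * T) / 2 * ∑ i ∈ Finset.range n, ξ i ^ 2
    ≤ Real.log (12 / δ) + n * (Real.log (2 * T) / 2)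
  total_le : 3 / 8 * ∑ i ∈ Finset.range T, ξ i ^ 2 ≤ Real.log (4 / δ) + T * Real.log 2

theorem measure_not_noiseControlled_le [MeasurableSpace 𝒳] {K : H → 𝒳 → 𝒳 → ℝ}
    (hK : ∀ θ, IsKernel (K θ)) (hKm : ∀ θ, Measurable (Function.uncurry (K θ))) {σ δ : ℝ}
    (hσ : 0 < σ) (hδ : 0 < δ) {T : ℕ} (hT : 0 < T) {s : Finset H} (hs : s.Nonempty)
    {Ω : Type*} {mΩ : MeasurableSpace Ω} {P : Measure Ω} [IsProbabilityMeasure P]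
    {ℱ : Filtration ℕ mΩ} {x : ℕ → Ω → 𝒳} (hx : ∀ n < T, Measurable[ℱ n] (x n))
    {ξ : ℕ → Ω → ℝ} (hξm : ∀ n < T, Measurable[ℱ (n + 1)] (ξ n))
    (hξ : CondSubGaussian P ℱ ξ 1 T) :
    P {ω | ¬NoiseControlled K σ δ T s (x · ω) (ξ · ω)} ≤ ENNReal.ofReal (δ / 2) := by
  have hT1 : (1 : ℝ) ≤ T := by exact_mod_cast hT
  set fit : Set Ω := {ω | ∃ θ ∈ s, ∃ n ≤ T,
    2 * (infoGain (K θ) σ (initSeg (x · ω) n) + Real.log (s.card / (δ / 6)))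
      ≤ fitQuad (K θ) σ (initSeg (x · ω) n) (initSeg (ξ · ω) n)}
  set energy : ℝ → ℝ → Set Ω := fun v δ => {ω | ∃ n ≤ T, Real.log δ⁻¹ + n * (Real.log (1 + v) / 2)
    ≤ v / (1 + v) / 2 * ∑ i ∈ Finset.range n, ξ i ω ^ 2}
  have hfit : P fit ≤ ENNReal.ofReal (δ / 6) :=
    measure_exists_mem_finset_le_fitQuad_le hK hKm hσ hx hξm hξ (by positivity) hs
  have henergy : P (energy (2 * T - 1) (δ / 12)) ≤ ENNReal.ofReal (δ / 12) :=
    measure_exists_le_sum_sq_le hξm hξ (by linarith) (by positivity)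
  have htotal : P (energy 3 (δ / 4)) ≤ ENNReal.ofReal (δ / 4) :=
    measure_exists_le_sum_sq_le hξm hξ (by norm_num) (by positivity)
  have hsub : {ω | ¬NoiseControlled K σ δ T s (x · ω) (ξ · ω)}
      ⊆ fit ∪ energy (2 * T - 1) (δ / 12) ∪ energy 3 (δ / 4) := by
    refine fun ω hω => by_contra fun hnot => hω ?_
    simp only [Set.mem_union, not_or] at hnot
    obtain ⟨⟨hfitω, henergyω⟩, htotalω⟩ := hnot
    simp only [fit, energy, Set.mem_ofPred_eq, not_exists, not_and, not_le, inv_div,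
      add_sub_cancel] at hfitω henergyω htotalω
    have hlog_card : Real.log (s.card / (δ / 6)) = Real.log (6 * s.card / δ) := by
      rw [div_div_eq_mul_div, mul_comm]
    refine ⟨fun θ hθ n hn => hlog_card ▸ (hfitω θ hθ n hn).le, fun n hn => (henergyω n hn).le, ?_⟩
    have h := (htotalω T le_rfl).le
    have hlog : Real.log (1 + 3) / 2 = Real.log 2 := by
      rw [show (1 : ℝ) + 3 = 2 ^ 2 by norm_num, Real.log_pow]
      ring
    rw [hlog] at h
    linarith
  calc P {ω | ¬NoiseControlled K σ δ T s (x · ω) (ξ · ω)}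
      ≤ P fit + P (energy (2 * T - 1) (δ / 12)) + P (energy 3 (δ / 4)) :=
        (measure_mono hsub).trans
          ((measure_union_le _ _).trans (by gcongr; exact measure_union_le _ _))
    _ ≤ ENNReal.ofReal (δ / 6) + ENNReal.ofReal (δ / 12) + ENNReal.ofReal (δ / 4) := by gcongr
    _ = ENNReal.ofReal (δ / 2) := by
        rw [← ENNReal.ofReal_add (by positivity) (by positivity),
          ← ENNReal.ofReal_add (by positivity) (by positivity)]
        ring_nf

end NoiseControlled

section UniformConfidence

theorem div_add_mul_le_of_energy_le {t n l L W : ℝ} (ht : 1 ≤ t) (hn : 0 ≤ n) (hnt : n ≤ t - 1)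
    (hl : 1 ≤ l) (hW : 0 ≤ W) (henergy : (2 * t - 1) * W ≤ 4 * t * (t * (t - 1) / 2 + L + 7 / 10))
    (hL : t * (t - 1) * (2 * t - 1) / 2 ≤ L) : n / (n + l) * W ≤ 2 * (1 + L) := by
  have hratio : n / (n + l) ≤ (t - 1) / t := by
    rw [div_le_div_iff₀ (by positivity) (by positivity)]
    nlinarith
  have : 0 ≤ (t - 1) / t := div_nonneg (by linarith) (by linarith)
  have hscaled : (2 * t - 1) * ((t - 1) / t * W) ≤ (2 * t - 1) * (2 * (1 + L)) :=
    calc (2 * t - 1) * ((t - 1) / t * W) = (t - 1) / t * ((2 * t - 1) * W) := by ring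
      _ ≤ (t - 1) / t * (4 * t * (t * (t - 1) / 2 + L + 7 / 10)) := by gcongr
      _ = 4 * (t - 1) * (t * (t - 1) / 2 + L + 7 / 10) := by field_simp
      _ ≤ (2 * t - 1) * (2 * (1 + L)) := by nlinarith
  calc n / (n + l) * W ≤ (t - 1) / t * W := by gcongr
    _ ≤ 2 * (1 + L) := le_of_mul_le_mul_left hscaled (by linarith)

theorem mul_le_two_mul_pow_of_energy_le {t n L W : ℝ} (ht : 2 ≤ t) (hnt : n ≤ t - 1) (hW : 0 ≤ W)
    (henergy : (2 * t - 1) * W ≤ 4 * t * (t * (t - 1) / 2 + L + 7 / 10))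
    (hL : L ≤ t * (t - 1) * (2 * t - 1) / 2) : n * W ≤ 2 * t ^ 4 := by
  have ht1 : 0 ≤ t - 1 := by linarith
  have hcubic : 2 * (t - 1) * (t ^ 2 * (t - 1) + 7 / 10) ≤ t ^ 3 * (2 * t - 1) := by
    nlinarith [mul_nonneg (sq_nonneg t) (by linarith : (0 : ℝ) ≤ t - 2)]
  have hscaled : (2 * t - 1) * (n * W) ≤ (2 * t - 1) * (2 * t ^ 4) :=
    calc (2 * t - 1) * (n * W) ≤ (t - 1) * ((2 * t - 1) * W) := by
          have : 0 ≤ (2 * t - 1) * W := mul_nonneg (by linarith) hW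
          nlinarith
      _ ≤ (t - 1) * (4 * t * (t ^ 2 * (t - 1) + 7 / 10)) := by
          refine mul_le_mul_of_nonneg_left (henergy.trans ?_) ht1
          gcongr
          nlinarith
      _ = 2 * t * (2 * (t - 1) * (t ^ 2 * (t - 1) + 7 / 10)) := by ring
      _ ≤ 2 * t * (t ^ 3 * (2 * t - 1)) := by gcongr
      _ = (2 * t - 1) * (2 * t ^ 4) := by ring
  exact le_of_mul_le_mul_left hscaled (by linarith)

variable {𝒳 H : Type*} {K : H → 𝒳 → 𝒳 → ℝ} {σ B R δ : ℝ} {T n : ℕ} {s : Finset H} {x : ℕ → 𝒳}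
  {ξ : ℕ → ℝ}

theorem NoiseControlled.energy_mul_le (h : NoiseControlled K σ δ T s x ξ) (hδ : 0 < δ)
    (hn : n < T) : (2 * T - 1) * ∑ i ∈ Finset.range n, ξ i ^ 2
      ≤ 4 * T * (T * (T - 1) / 2 + Real.log (6 / δ) + 7 / 10) := by
  have hT1 : (1 : ℝ) ≤ T := by exact_mod_cast hn.pos
  have hnT : (n : ℝ) ≤ T - 1 := le_sub_iff_add_le.2 (by exact_mod_cast hn)
  have hlog_two : Real.log 2 ≤ 7 / 10 := by linarith [Real.log_two_lt_d9]
  have hlog_T : Real.log (2 * T) ≤ T := by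
    rw [Real.log_mul two_ne_zero (by positivity)]
    linarith [Real.log_le_sub_one_of_pos (show (0 : ℝ) < T by linarith)]
  have hlog_δ : Real.log (12 / δ) = Real.log (6 / δ) + Real.log 2 := by
    rw [← Real.log_mul (by positivity) two_ne_zero]
    ring_nf
  have henergy : (2 * T - 1) / (2 * T) / 2 * ∑ i ∈ Finset.range n, ξ i ^ 2
      ≤ T * (T - 1) / 2 + Real.log (6 / δ) + 7 / 10 := by
    have : n * (Real.log (2 * T) / 2) ≤ (T - 1) * (T / 2) := by
      gcongr
      exact div_nonneg (Real.log_nonneg (by linarith)) zero_le_two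
    linarith [h.energy_le n hn.le]
  calc (2 * T - 1) * ∑ i ∈ Finset.range n, ξ i ^ 2
      = 4 * T * ((2 * T - 1) / (2 * T) / 2 * ∑ i ∈ Finset.range n, ξ i ^ 2) := by
        field_simp
        ring
    _ ≤ _ := by gcongr

/-- Passing from a kernel to the nearest one of the net costs at most
`T⁻⁴ * n * ∑ i, ξ i ^ 2`, which is bounded unless `log (6 / δ)` exceeds a cubic in `T`; in that case
the crude bound `fitQuad ≤ n / (n + σ ^ 2) * ∑ i, ξ i ^ 2` suffices. -/
theorem NoiseControlled.fitQuad_le (h : NoiseControlled K σ δ T s x ξ) (hK : ∀ θ, IsKernel (K θ))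
    (hK1 : ∀ θ z z', K θ z z' ≤ 1) (hσ : 1 ≤ σ) (hδ₀ : 0 < δ) (hT : 1 < T)
    (hs : ∀ θ, ∃ θ' ∈ s, kernelDist (K θ) (K θ') ≤ resolution T) (hn : n < T) (θ : H) :
    fitQuad (K θ) σ (initSeg x n) (initSeg ξ n)
      ≤ 2 * (familyInfoGain K σ n + 1 + Real.log (6 * s.card / δ)) := by
  have hσ0 : 0 < σ := by linarith
  have hσ2 : 1 ≤ σ ^ 2 := one_le_pow₀ hσ
  have hT2 : (2 : ℝ) ≤ T := by exact_mod_cast hT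
  have hnT : (n : ℝ) ≤ T - 1 := le_sub_iff_add_le.2 (by exact_mod_cast hn)
  have hres : 0 ≤ resolution T := by rw [resolution]; positivity
  obtain ⟨θ', hθ's, hθθ'⟩ := hs θ
  have hΓ : 0 ≤ familyInfoGain K σ n := familyInfoGain_nonneg hK hσ0 n
  have hlog : Real.log (6 / δ) ≤ Real.log (6 * s.card / δ) := by
    have : (1 : ℝ) ≤ s.card := by exact_mod_cast Finset.card_pos.2 ⟨θ', hθ's⟩
    gcongr
    linarith
  have hnorm : initSeg ξ n ⬝ᵥ initSeg ξ n = ∑ i ∈ Finset.range n, ξ i ^ 2 := by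
    simp only [dotProduct_initSeg, sq]
  have hW : 0 ≤ ∑ i ∈ Finset.range n, ξ i ^ 2 := Finset.sum_nonneg fun _ _ => sq_nonneg _
  have henergy := h.energy_mul_le hδ₀ hn
  rcases le_total ((T : ℝ) * (T - 1) * (2 * T - 1) / 2) (Real.log (6 / δ)) with hL | hL
  · have hcrude := (hK θ).fitQuad_le (hK1 θ) hσ0 (initSeg x n) (initSeg ξ n)
    rw [hnorm] at hcrude
    linarith [div_add_mul_le_of_energy_le (by linarith) n.cast_nonneg hnT hσ2 hW henergy hL]
  · have hnear := (hK θ).fitQuad_le_add (hK θ') hσ0 hres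
      (fun z z' => ((hK θ).abs_sub_le_kernelDist (hK θ') (hK1 θ) (hK1 θ') z z').trans hθθ')
      (initSeg x n) (initSeg ξ n)
    have hcost : resolution T * n * (∑ i ∈ Finset.range n, ξ i ^ 2) / σ ^ 2 ≤ 2 := by
      rw [div_le_iff₀ (by positivity), resolution, mul_assoc, inv_mul_le_iff₀ (by positivity)]
      have := mul_le_two_mul_pow_of_energy_le hT2 hnT hW henergy hL
      have : 0 ≤ (T : ℝ) ^ 4 := by positivity
      nlinarith
    have hcentre := h.fit_le θ' hθ's n hn.le
    have hgain := infoGain_le_familyInfoGain hK hK1 θ' (initSeg x n) (σ := σ)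
    rw [hnorm] at hnear
    linarith

theorem NoiseControlled.abs_sub_postMean_le (h : NoiseControlled K σ δ T s x ξ)
    (hK : ∀ θ, IsKernel (K θ)) (hK1 : ∀ θ z z', K θ z z' ≤ 1) (hσ : 1 ≤ σ) (hδ₀ : 0 < δ)
    (hT : 1 < T) (hcard : s.card = coveringNumber K (resolution T))
    (hs : ∀ θ, ∃ θ' ∈ s, kernelDist (K θ) (K θ') ≤ resolution T) (hn : n < T) {θ : H}
    {f : 𝒳 → ℝ} (hB : 0 ≤ B) (hf : rkhsNorm (hK θ) f ≤ ENNReal.ofReal B) (hR : 0 ≤ R) {y : ℕ → ℝ}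
    (hy : ∀ i < T, y i = f (x i) + R * ξ i) (z : 𝒳) :
    |f z - postMean (K θ) σ (initSeg x n) (initSeg y n) z|
      ≤ betaSqrt K σ B R δ T n * postStd (K θ) σ (initSeg x n) z := by
  have hσ0 : 0 < σ := by linarith
  have hnoise : √(fitQuad (K θ) σ (initSeg x n) (R • initSeg ξ n)) / σ
      ≤ R * √(2 * (familyInfoGain K σ n + 1 + Real.log (6 * s.card / δ))) := by
    rw [fitQuad_smul, Real.sqrt_mul (sq_nonneg R), Real.sqrt_sq hR]
    refine (div_le_self (by positivity) hσ).trans ?_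
    gcongr
    exact h.fitQuad_le hK hK1 hσ hδ₀ hT hs hn θ
  have hobs : initSeg y n = fun i => f (initSeg x n i) + (R • initSeg ξ n) i :=
    funext fun i => hy i (i.2.trans hn)
  rw [hobs]
  refine ((hK θ).abs_sub_postMean_add_le hσ0 hB hf (initSeg x n) (R • initSeg ξ n) z).trans ?_
  rw [betaSqrt, ← hcard]
  exact mul_le_mul_of_nonneg_right (by gcongr) (Real.sqrt_nonneg _)

end UniformConfidence

section FeasibilityMargin

variable {𝒳 H : Type*} {K : H → 𝒳 → 𝒳 → ℝ} {σ B R δ : ℝ} {T p n : ℕ} {s : Finset H} {x : ℕ → 𝒳}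
  {ξ : ℕ → ℝ}

/-- The prediction error of round `n + 1` for the hyperparameter `θ`, in units of its allowance
`betaSqrt * √(postVar + σ ^ 2)`; the calibration constraint compares its `p`-th power with `1`. -/
def calibRatio (K : H → 𝒳 → 𝒳 → ℝ) (σ B R δ : ℝ) (T : ℕ) (x : ℕ → 𝒳) (y : ℕ → ℝ) (n : ℕ)
    (θ : H) : ℝ :=
  |y n - postMean (K θ) σ (initSeg x n) (initSeg y n) (x n)|
    / (betaSqrt K σ B R δ T n * √(postVar (K θ) σ (initSeg x n) (x n) + σ ^ 2))

theorem calibLoss_eq (y : ℕ → ℝ) (θ : H) :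
    calibLoss K σ B R δ T p x y n θ = calibRatio K σ B R δ T x y n θ ^ p - 1 := by
  rw [calibLoss, calibRatio, div_pow]

theorem betaSqrt_nonneg (hB : 0 ≤ B) (hR : 0 ≤ R) : 0 ≤ betaSqrt K σ B R δ T n := by
  rw [betaSqrt]
  positivity

theorem le_feasibilityMargin (hB : 0 ≤ B) (hR : 0 ≤ R) (y : ℕ → ℝ) (θ : H) :
    1 / (T : ℝ) * ∑ n ∈ Finset.range T, (1 - calibRatio K σ B R δ T x y n θ ^ p)
      ≤ feasibilityMargin K σ B R δ T p x y := by
  have hbdd : BddAbove (Set.range fun θ =>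
      1 / (T : ℝ) * ∑ n ∈ Finset.range T, -calibLoss K σ B R δ T p x y n θ) := by
    refine ⟨1, Set.forall_mem_range.2 fun θ => ?_⟩
    have hterm : ∀ n, -calibLoss K σ B R δ T p x y n θ ≤ 1 := fun n => by
      have : 0 ≤ calibRatio K σ B R δ T x y n θ :=
        div_nonneg (abs_nonneg _) (mul_nonneg (betaSqrt_nonneg hB hR) (Real.sqrt_nonneg _))
      rw [calibLoss_eq]
      linarith [pow_nonneg this p]
    calc 1 / (T : ℝ) * ∑ n ∈ Finset.range T, -calibLoss K σ B R δ T p x y n θ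
        ≤ 1 / (T : ℝ) * ∑ _n ∈ Finset.range T, 1 := by gcongr; exact hterm _
      _ = (T : ℝ)⁻¹ * T := by simp
      _ ≤ 1 := inv_mul_le_one
  refine (le_ciSup hbdd θ).trans_eq' ?_
  simp only [calibLoss_eq, neg_sub]

theorem IsKernel.sum_calibRatio_sq_le {θ : H} (hK : IsKernel (K θ)) (hσ : 0 < σ) {b : ℝ}
    (hb : 0 < b) (hβ : ∀ n, b ≤ betaSqrt K σ B R δ T n) (y : ℕ → ℝ) (N : ℕ) :
    ∑ n ∈ Finset.range N, calibRatio K σ B R δ T x y n θ ^ 2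
      ≤ invQuad (K θ) σ (initSeg x N) (initSeg y N) / b ^ 2 := by
  rw [← hK.sum_sq_div_eq_invQuad hσ, Finset.sum_div]
  gcongr with n
  have hvar : 0 < postVar (K θ) σ (initSeg x n) (x n) + σ ^ 2 :=
    add_pos_of_nonneg_of_pos (hK.postVar_nonneg hσ _ _) (by positivity)
  rw [calibRatio, div_pow, mul_pow, sq_abs, Real.sq_sqrt hvar.le, mul_comm, ← div_div]
  gcongr
  exact hβ n

theorem marginBound_le_average (hT : 0 < T) (hp : p = 1 ∨ p = 2) {r : ℕ → ℝ}
    (hr : ∑ n ∈ Finset.range T, r n ^ 2 ≤ 3 / 4 * T) :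
    marginBound σ p ≤ 1 / (T : ℝ) * ∑ n ∈ Finset.range T, (1 - r n ^ p) := by
  have hT0 : (0 : ℝ) < T := by exact_mod_cast hT
  have hsum : ∀ p, ∑ n ∈ Finset.range T, (1 - r n ^ p) = T - ∑ n ∈ Finset.range T, r n ^ p :=
    fun p => by simp
  rw [one_div, le_inv_mul_iff₀ hT0, hsum, marginBound]
  rcases hp with rfl | rfl
  · have hAMGM : ∑ n ∈ Finset.range T, r n ^ 1 ≤ ∑ n ∈ Finset.range T, (1 + r n ^ 2) / 2 :=
      Finset.sum_le_sum fun n _ => by linarith [sq_nonneg (r n - 1)]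
    rw [← Finset.sum_div, Finset.sum_add_distrib, Finset.sum_const, Finset.card_range,
      nsmul_one] at hAMGM
    rw [if_pos rfl]
    linarith
  · have hquarter : σ ^ 2 / (4 * (1 + σ ^ 2)) ≤ 1 / 4 := by
      rw [div_le_div_iff₀ (by positivity) (by norm_num)]
      linarith
    rw [if_neg (by norm_num)]
    nlinarith

theorem marginBound_pos (hσ : 0 < σ) : 0 < marginBound σ p := by
  rw [marginBound]
  split_ifs <;> positivity

theorem NoiseControlled.sum_sq_le (h : NoiseControlled K σ δ T s x ξ) (hδ₀ : 0 < δ) (hδ₁ : δ ≤ 1)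
    (hT : 1 < T) :
    ∑ i ∈ Finset.range T, ξ i ^ 2 ≤ 3 / 4 * T * (2 * (1 + Real.log (6 / δ))) := by
  have hT2 : (2 : ℝ) ≤ T := by exact_mod_cast hT
  have hlog_two : T * Real.log 2 ≤ T * (7 / 10) := by
    gcongr
    linarith [Real.log_two_lt_d9]
  have hlog_six : 5 / 6 ≤ Real.log (6 / δ) := by
    have := Real.one_sub_inv_le_log_of_pos (show 0 < 6 / δ by positivity)
    rw [inv_div] at this
    linarith
  have hlog_four : Real.log (4 / δ) ≤ Real.log (6 / δ) - 1 / 3 := by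
    have hsplit : Real.log (6 / δ) = Real.log (4 / δ) + Real.log (3 / 2) := by
      rw [← Real.log_mul (by positivity) (by norm_num)]
      ring_nf
    have := Real.one_sub_inv_le_log_of_pos (show (0 : ℝ) < 3 / 2 by norm_num)
    linarith
  nlinarith [h.total_le, mul_nonneg (sub_nonneg.2 hT2) (sub_nonneg.2 hlog_six)]

theorem add_mul_sqrt_le_betaSqrt (hK : ∀ θ, IsKernel (K θ)) (hσ : 0 < σ) (hδ : 0 < δ)
    (hR : 0 ≤ R) (hN : 0 < coveringNumber K (resolution T)) :
    B + R * √(2 * (1 + Real.log (6 / δ))) ≤ betaSqrt K σ B R δ T n := by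
  have hN1 : (1 : ℝ) ≤ coveringNumber K (resolution T) := by exact_mod_cast hN
  have hlog : Real.log (6 / δ) ≤ Real.log (6 * coveringNumber K (resolution T) / δ) := by
    gcongr
    linarith
  rw [betaSqrt]
  gcongr
  linarith [familyInfoGain_nonneg hK hσ n]

theorem NoiseControlled.marginBound_le_feasibilityMargin (h : NoiseControlled K σ δ T s x ξ)
    (hK : ∀ θ, IsKernel (K θ)) (hσ : 1 ≤ σ) (hδ₀ : 0 < δ) (hδ₁ : δ ≤ 1) (hT : 1 < T)
    (hp : p = 1 ∨ p = 2) (hN : 0 < coveringNumber K (resolution T)) {θ : H} {f : 𝒳 → ℝ}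
    (hB : 0 ≤ B) (hf : rkhsNorm (hK θ) f ≤ ENNReal.ofReal B) (hR : 0 < R) {y : ℕ → ℝ}
    (hy : ∀ i < T, y i = f (x i) + R * ξ i) :
    marginBound σ p ≤ feasibilityMargin K σ B R δ T p x y := by
  have hσ0 : 0 < σ := by linarith
  have hT2 : (2 : ℝ) ≤ T := by exact_mod_cast hT
  have hL : 0 ≤ Real.log (6 / δ) := Real.log_nonneg (by rw [le_div_iff₀ hδ₀]; linarith)
  set b₀ := √(2 * (1 + Real.log (6 / δ)))
  have : 0 < b₀ := Real.sqrt_pos.2 (by linarith)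
  have hb₀_sq : b₀ ^ 2 = 2 * (1 + Real.log (6 / δ)) := Real.sq_sqrt (by linarith)
  set W := ∑ i ∈ Finset.range T, ξ i ^ 2
  have hW : W ≤ 3 / 4 * T * b₀ ^ 2 := hb₀_sq ▸ h.sum_sq_le hδ₀ hδ₁ hT
  have hnorm : (R • initSeg ξ T) ⬝ᵥ (R • initSeg ξ T) = R ^ 2 * W := by
    simp only [smul_dotProduct, dotProduct_smul, dotProduct_initSeg, smul_eq_mul, W, sq]
    ring
  have hobs : initSeg y T = fun i => f (initSeg x T i) + (R • initSeg ξ T) i :=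
    funext fun i => hy i i.2
  have hquad : invQuad (K θ) σ (initSeg x T) (initSeg y T)
      ≤ 3 / 4 * T * (B + R * b₀) ^ 2 :=
    calc invQuad (K θ) σ (initSeg x T) (initSeg y T)
        ≤ B ^ 2 + R ^ 2 * W / σ ^ 2 := by
          rw [hobs, ← hnorm]
          exact (hK θ).invQuad_add_le hσ0 hB hf _ _
      _ ≤ B ^ 2 + R ^ 2 * W := by
          gcongr
          exact div_le_self (by positivity) (one_le_pow₀ hσ)
      _ ≤ 3 / 4 * T * B ^ 2 + R ^ 2 * (3 / 4 * T * b₀ ^ 2) := by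
          gcongr
          nlinarith [sq_nonneg B]
      _ ≤ 3 / 4 * T * (B + R * b₀) ^ 2 := by
          have : 0 ≤ 3 / 4 * T * (B * (R * b₀)) := by positivity
          linarith
  have hb : 0 < B + R * b₀ := by positivity
  refine (marginBound_le_average (by omega) hp ?_).trans (le_feasibilityMargin hB hR.le _ θ)
  refine ((hK θ).sum_calibRatio_sq_le hσ0 hb
    (fun n => add_mul_sqrt_le_betaSqrt hK hσ0 hδ₀ hR.le hN) _ T).trans ?_
  rwa [div_le_iff₀ (by positivity)]

end FeasibilityMargin

end OSCBO

end

theorem mainTheorem2_general {Ω : Type*} {mΩ : MeasurableSpace Ω} (P : Measure Ω)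
    [IsProbabilityMeasure P] {𝒳 H : Type*} [MeasurableSpace 𝒳] [Nonempty H]
    (k : H → 𝒳 → 𝒳 → ℝ) (hk : ∀ θ, IsKernel (k θ)) (hk_le : ∀ θ x x', k θ x x' ≤ 1)
    (hk_meas : ∀ θ, Measurable (Function.uncurry (k θ))) (f : 𝒳 → ℝ) (B R σ δ : ℝ) (hB : 0 ≤ B)
    (hR : 0 < R) (hσ : 1 ≤ σ) (hδ₀ : 0 < δ) (hδ₁ : δ ≤ 1)
    (hf : ∀ θ, rkhsNorm (hk θ) f ≤ ENNReal.ofReal B) (T : ℕ) (hT : 1 < T)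
    (hcover : ∃ s : Finset H, ∀ θ, ∃ θ' ∈ s, kernelDist (k θ) (k θ') ≤ resolution T) (p : ℕ)
    (hp : p = 1 ∨ p = 2) (ℱ : Filtration ℕ mΩ) (x : ℕ → Ω → 𝒳) (ε y : ℕ → Ω → ℝ)
    (hx : ∀ n < T, Measurable[ℱ n] (x n)) (hε : ∀ n < T, Measurable[ℱ (n + 1)] (ε n))
    (hsub : CondSubGaussian P ℱ ε R T) (hy : ∀ n < T, ∀ ω, y n ω = f (x n ω) + ε n ω) :
    ∃ E : Set Ω, MeasurableSet E ∧ ENNReal.ofReal (1 - δ / 2) ≤ P E ∧ ∀ ω ∈ E,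
      marginBound σ p ≤ feasibilityMargin k σ B R δ T p (fun n => x n ω) (fun n => y n ω) ∧
      ∀ n < T, ∀ (z : 𝒳) (θ : H),
        |f z - postMean (k θ) σ (fun i : Fin n => x i ω) (fun i => y i ω) z|
          ≤ betaSqrt k σ B R δ T n * postStd (k θ) σ (fun i : Fin n => x i ω) z := by
  obtain ⟨s, hs⟩ := hcover
  obtain ⟨t, hcard, ht⟩ := exists_finset_card_eq_coveringNumber hs
  obtain ⟨θ₀⟩ := ‹Nonempty H›
  have ht_nonempty : t.Nonempty := (ht θ₀).imp fun _ h => h.1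
  have hN : 0 < coveringNumber k (resolution T) := hcard ▸ ht_nonempty.card_pos
  set bad := {ω | ¬NoiseControlled k σ δ T t (x · ω) fun n => ε n ω / R}
  have hbad : P bad ≤ ENNReal.ofReal (δ / 2) :=
    measure_not_noiseControlled_le hk hk_meas (by linarith) hδ₀ (by omega) ht_nonempty hx
      (fun n hn => (hε n hn).div_const R) (hsub.div hR)
  have hobs : ∀ ω, ∀ n < T, y n ω = f (x n ω) + R * (ε n ω / R) := fun ω n hn => by
    rw [hy n hn, mul_div_cancel₀ _ hR.ne']
  refine ⟨(toMeasurable P bad)ᶜ, (measurableSet_toMeasurable P bad).compl, ?_, fun ω hω => ?_⟩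
  · rw [prob_compl_eq_one_sub (measurableSet_toMeasurable P bad), measure_toMeasurable,
      ENNReal.ofReal_sub _ (by positivity), ENNReal.ofReal_one]
    gcongr
  have hgood : NoiseControlled k σ δ T t (x · ω) fun n => ε n ω / R :=
    not_not.1 fun h => hω (subset_toMeasurable P bad h)
  exact ⟨hgood.marginBound_le_feasibilityMargin hk hσ hδ₀ hδ₁ hT hp hN hB (hf θ₀) hR (hobs ω),
    fun n hn z θ => hgood.abs_sub_postMean_le hk hk_le hσ hδ₀ hT hcard ht hn hB (hf θ) hR.le
      (hobs ω) z⟩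

theorem mainTheorem2
    {Ω : Type*} {mΩ : MeasurableSpace Ω} (P : Measure Ω) [IsProbabilityMeasure P]
    {d m : ℕ} (𝒳 : Set (EuclideanSpace ℝ (Fin d))) (h𝒳 : IsCompact 𝒳)
    (Θ : Set (Fin m → ℝ)) (k : Θ → 𝒳 → 𝒳 → ℝ)
    (hk : ∀ θ, IsKernel (k θ)) (hk_le : ∀ θ x x', k θ x x' ≤ 1)
    (hk_cont : Continuous fun q : Θ × 𝒳 × 𝒳 => k q.1 q.2.1 q.2.2)
    (f : 𝒳 → ℝ) (B R σ δ : ℝ) (hB : 0 < B) (hR : 0 < R) (hσ : 1 ≤ σ)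
    (hδ₀ : 0 < δ) (hδ₁ : δ < 1)
    (hf : RKHSAssumption Θ hk f B)
    (T : ℕ) (hT : 1 < T) (p : ℕ) (hp : p = 1 ∨ p = 2)
    (ℱ : Filtration ℕ mΩ) (x : ℕ → Ω → 𝒳) (ε y : ℕ → Ω → ℝ)
    (hx : ∀ n < T, Measurable[ℱ n] (x n)) (hε : ∀ n < T, Measurable[ℱ (n + 1)] (ε n))
    (hsub : CondSubGaussian P ℱ ε R T)
    (hy : ∀ n < T, ∀ ω, y n ω = f (x n ω) + ε n ω) :
    0 < marginBound σ p ∧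
    ∃ E : Set Ω, MeasurableSet E ∧ ENNReal.ofReal (1 - δ / 2) ≤ P E ∧ ∀ ω ∈ E,
      marginBound σ p
        ≤ feasibilityMargin k σ B R δ T p (fun n => x n ω) (fun n => y n ω) ∧
      ∀ n < T, ∀ (z : 𝒳) (θ : Θ),
        |f z - postMean (k θ) σ (fun i : Fin n => x i ω) (fun i => y i ω) z|
          ≤ betaSqrt k σ B R δ T n * postStd (k θ) σ (fun i : Fin n => x i ω) z
            + √(lipVar σ n * resolution T)
            + lipMean σ (fun i : Fin n => y i ω) * resolution T := by
  have : CompactSpace 𝒳 := isCompact_iff_compactSpace.1 h𝒳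
  have : CompactSpace Θ := isCompact_iff_compactSpace.1 hf.isCompact
  have : Nonempty Θ := hf.mem_rkhs.nonempty
  have hk_meas : ∀ θ, Measurable (Function.uncurry (k θ)) := fun θ =>
    (hk_cont.comp (Continuous.prodMk_right θ)).measurable
  have hres : 0 < resolution T := by
    rw [resolution]
    positivity
  obtain ⟨E, hE, hPE, hgood⟩ := mainTheorem2_general P k hk hk_le hk_meas f B R σ δ hB.le hR hσ hδ₀
    hδ₁.le (fun θ => (le_iSup _ θ).trans hf.norm_le) T hT
    (exists_finset_forall_kernelDist_le hk_cont hres) p hp ℱ x ε y hx hε hsub hy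
  refine ⟨marginBound_pos (by linarith), E, hE, hPE, fun ω hω => ⟨(hgood ω hω).1, ?_⟩⟩
  intro n hn z θ
  have hlip : 0 ≤ lipMean σ (fun i : Fin n => y i ω) * resolution T := by
    rw [lipMean]
    positivity
  linarith [(hgood ω hω).2 n hn z θ, Real.sqrt_nonneg (lipVar σ n * resolution T)]
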